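/- Let $K$ be an algebraically closed field, let $n\in\mathbb N_0$, and let $R=K[x_0,\dots,x_n]$ with its standard grading and irrelevant ideal $R_+$. Let $\mathfrak p\subset R$ be a closed point of $\operatorname{Proj}(R)$, i.e. a maximal element of the set of homogeneous prime ideals not containing $R_+$; let $\mathfrak p_1$ be the space of linear forms in $\mathfrak p$, and let $S=K[\mathfrak p_1]\subseteq R$ be the graded $K$-subalgebra generated by $\mathfrak p_1$. For each $y\in R_1\setminus\mathfrak p_1$ one has $R=S[y]$ (a polynomial ring), and $\deg_y$ denotes the degree in $y$ over $S$, with $\deg_y(0)=-\infty$. For a graded ideal $\mathfrak a\subseteq R$ the partial elimination ideals of $\mathfrak a$ with respect to $\mathfrak p$ are $$\mathcal K^{\mathfrak p}_k(\mathfrak a)=\{f\in S \mid \forall y\in R_1\setminus\mathfrak p_1\ \exists g\in R:\ \deg_y(g)<k \text{ and } y^kf+g\in\mathfrak a\}\quad(k\in\mathbb N_0),\qquad \mathcal K^{\mathfrak p}_{-1}(\mathfrak a)=0.$$ For a nonzero finitely generated graded module $M$ over $R$ or over $S$, of dimension $d$ and with Hilbert polynomial $p_M$, let $e_0(M)=\operatorname{length}(M)$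 if $d=0$, and let $e_0(M)$ be $(d-1)!$ times the leading coefficient of $p_M$ if $d>0$. **Theorem.** Let $\mathfrak a\subseteq R$ be a graded ideal with $\mathfrak a\not\subseteq\mathfrak p$, and let $\mathfrak q\subseteq S$ be a graded ideal such that $\overline S:=S/((\mathfrak a\cap S)+\mathfrak q)$ has Krull dimension $1$. Put $\overline R:=R/((\mathfrak a\cap S)R+\mathfrak qR)$, let $\overline R_+$ be the image of $R_+$ in $\overline R$, and let $\overline{\mathfrak a}$ be the image of $\mathfrak a+\mathfrak qR$ in $\overline R$. Assume that the saturation $\overline{\mathfrak a}^{\mathrm{sat}}=\bigcup_{m\ge 0}(\overline{\mathfrak a}:_{\overline R}\overline R_+^{\,m})$ is a principal ideal of $\overline R$. Then the maximum $$k_0:=\max\{k\in\mathbb N_0\cup\{-1\}\mid \mathcal K^{\mathfrak p}_k(\mathfrak a)\subseteq(\mathfrak a\cap S)+\mathfrak q\}$$ exists, and $$e_0\bigl(R/(\mathfrak a+\mathfrak qR)\bigr)=(k_0+1)\cdot e_0\bigl(S/((\mathfrak a\cap S)+\mathfrak q)\bigr).$$ -/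

import Mathlib

open MvPolynomial Polynomial
open scoped Nat

attribute [local instance] MvPolynomial.gradedAlgebra

namespace PartialElimination

section Rings

variable (K : Type*) [Field K] (n : ℕ)

/-- The polynomial ring `R = K[x_0, …, x_n]`. -/
abbrev PolyRing : Type _ := MvPolynomial (Fin (n + 1)) K

/-- The standard grading of `R`. -/
noncomputable abbrev stdGrading : ℕ → Submodule K (PolyRing K n) :=
  MvPolynomial.homogeneousSubmodule (Fin (n + 1)) K

end Rings

section Subring

variable {K : Type*} [Field K] {n : ℕ}

/-- The `K`-vector space `𝔭₁` of linear forms contained in `𝔭`. -/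
noncomputable def linearForms (𝔭 : Ideal (PolyRing K n)) : Submodule K (PolyRing K n) :=
  𝔭.restrictScalars K ⊓ stdGrading K n 1

/-- The homogeneous `K`-subalgebra `S = K[𝔭₁]` of `R`. -/
noncomputable abbrev coordSubalgebra (𝔭 : Ideal (PolyRing K n)) : Subalgebra K (PolyRing K n) :=
  Algebra.adjoin K (linearForms 𝔭 : Set (PolyRing K n))

/-- The grading of `S = K[𝔭₁]` induced by the standard grading of `R`: `S_d = S ∩ R_d`. -/
noncomputable def subGrading (𝔭 : Ideal (PolyRing K n)) (d : ℕ) : Submodule K (coordSubalgebra 𝔭) :=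
  (stdGrading K n d).comap (coordSubalgebra 𝔭).val.toLinearMap

theorem mem_subGrading {𝔭 : Ideal (PolyRing K n)} {d : ℕ} {f : coordSubalgebra 𝔭} :
    f ∈ subGrading 𝔭 d ↔ (f : PolyRing K n).IsHomogeneous d := Iff.rfl

theorem homogeneousComponent_mem (𝔭 : Ideal (PolyRing K n)) {f : PolyRing K n}
    (hf : f ∈ coordSubalgebra 𝔭) (d : ℕ) :
    MvPolynomial.homogeneousComponent d f ∈ coordSubalgebra 𝔭 := by
  induction hf using Algebra.adjoin_induction generalizing d with
  | mem x hx =>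
    rw [MvPolynomial.homogeneousComponent_of_mem (show x ∈ stdGrading K n 1 from hx.2)]
    split_ifs
    · exact Algebra.subset_adjoin hx
    · exact zero_mem _
  | algebraMap r =>
    have h : algebraMap K (PolyRing K n) r ∈ stdGrading K n 0 :=
      MvPolynomial.isHomogeneous_C _ _
    rw [MvPolynomial.homogeneousComponent_of_mem h]
    split_ifs
    · exact Subalgebra.algebraMap_mem _ r
    · exact zero_mem _
  | add x y _ _ hx hy =>
    rw [map_add]
    exact add_mem (hx d) (hy d)
  | mul x y _ _ hx hy =>
    have e : x * y = ∑ i ∈ Finset.range (x.totalDegree + 1),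
        ∑ j ∈ Finset.range (y.totalDegree + 1),
          MvPolynomial.homogeneousComponent i x * MvPolynomial.homogeneousComponent j y := by
      rw [← Finset.sum_mul_sum, MvPolynomial.sum_homogeneousComponent,
        MvPolynomial.sum_homogeneousComponent]
    rw [e, map_sum]
    refine sum_mem fun i _ => ?_
    rw [map_sum]
    refine sum_mem fun j _ => ?_
    have h : MvPolynomial.homogeneousComponent i x * MvPolynomial.homogeneousComponent j y
        ∈ stdGrading K n (i + j) :=
      (MvPolynomial.homogeneousComponent_isHomogeneous i x).mul
        (MvPolynomial.homogeneousComponent_isHomogeneous j y)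
    rw [MvPolynomial.homogeneousComponent_of_mem h]
    split_ifs
    · exact mul_mem (hx i) (hy j)
    · exact zero_mem _

theorem subGrading_isInternal (𝔭 : Ideal (PolyRing K n)) :
    DirectSum.IsInternal (subGrading 𝔭) := by
  have hR : DirectSum.IsInternal (stdGrading K n) := DirectSum.Decomposition.isInternal _
  have hinj : Function.Injective (coordSubalgebra 𝔭).val := Subtype.val_injective
  rw [DirectSum.isInternal_submodule_iff_iSupIndep_and_iSup_eq_top]
  constructor
  · rw [iSupIndep_def]
    intro d
    rw [Submodule.disjoint_def]
    intro f hf hf'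
    have h := (Submodule.disjoint_def.mp (hR.submodule_iSupIndep d)) (f : PolyRing K n) hf ?_
    · exact Subtype.ext h
    · have h1 : (⨆ j, ⨆ (_ : j ≠ d), subGrading 𝔭 j) ≤
          (⨆ j, ⨆ (_ : j ≠ d), stdGrading K n j).comap (coordSubalgebra 𝔭).val.toLinearMap := by
        refine iSup₂_le fun j hj => Submodule.comap_mono ?_
        exact le_iSup₂_of_le j hj le_rfl
      exact h1 hf'
  · rw [eq_top_iff]
    rintro ⟨f, hf⟩ -
    have e : (⟨f, hf⟩ : coordSubalgebra 𝔭) = ∑ i ∈ Finset.range (f.totalDegree + 1),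
        ⟨MvPolynomial.homogeneousComponent i f, homogeneousComponent_mem 𝔭 hf i⟩ := by
      apply Subtype.ext
      rw [AddSubmonoidClass.coe_finsetSum]
      exact (MvPolynomial.sum_homogeneousComponent f).symm
    rw [e]
    refine sum_mem fun i _ => Submodule.mem_iSup_of_mem i ?_
    exact MvPolynomial.homogeneousComponent_isHomogeneous i f

noncomputable instance subGradedAlgebra (𝔭 : Ideal (PolyRing K n)) :
    GradedAlgebra (subGrading 𝔭) :=
  { (subGrading_isInternal 𝔭).chooseDecomposition with
    one_mem := MvPolynomial.isHomogeneous_one _ _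
    mul_mem := fun _ _ _ _ hf hg => MvPolynomial.IsHomogeneous.mul hf hg }

end Subring

section PEI

variable {K : Type*} [Field K] {n : ℕ}

/-- For `R = S[y]`: the element `g` is a polynomial in `y` over `S = K[𝔭₁]` of degree `< k`,
that is `deg_y(g) < k`, with `deg_y(0) = -∞`. -/
def DegLT (𝔭 : Ideal (PolyRing K n)) (y g : PolyRing K n) (k : ℕ) : Prop :=
  ∃ P : Polynomial (coordSubalgebra 𝔭), P.degree < (k : WithBot ℕ) ∧ Polynomial.aeval y P = g

/-- The partial elimination ideal `𝒦_k^𝔭(𝔞)` for `k ∈ ℕ`: all `f ∈ S` such that for every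
`y ∈ R₁ ∖ 𝔭₁` there is `g ∈ R` with `deg_y(g) < k` and `y ^ k * f + g ∈ 𝔞`. -/
noncomputable def natPEI (𝔭 𝔞 : Ideal (PolyRing K n)) (k : ℕ) : Ideal (coordSubalgebra 𝔭) where
  carrier := {f | ∀ y ∈ stdGrading K n 1, y ∉ linearForms 𝔭 →
    ∃ g : PolyRing K n, DegLT 𝔭 y g k ∧ y ^ k * (f : PolyRing K n) + g ∈ 𝔞}
  zero_mem' := by
    intro y _ _
    exact ⟨0, ⟨0, by simp, by simp⟩, by simp⟩
  add_mem' := by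
    intro a b ha hb y hy hy'
    obtain ⟨g, ⟨P, hP, rfl⟩, hg⟩ := ha y hy hy'
    obtain ⟨g', ⟨P', hP', rfl⟩, hg'⟩ := hb y hy hy'
    refine ⟨_, ⟨P + P', (Polynomial.degree_add_le _ _).trans_lt (max_lt hP hP'), rfl⟩, ?_⟩
    have e : y ^ k * ((a + b : coordSubalgebra 𝔭) : PolyRing K n) + Polynomial.aeval y (P + P')
        = (y ^ k * (a : PolyRing K n) + Polynomial.aeval y P)
          + (y ^ k * (b : PolyRing K n) + Polynomial.aeval y P') := by
      rw [map_add, Subalgebra.coe_add]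
      ring
    rw [e]
    exact add_mem hg hg'
  smul_mem' := by
    intro c f hf y hy hy'
    obtain ⟨g, ⟨P, hP, rfl⟩, hg⟩ := hf y hy hy'
    refine ⟨_, ⟨c • P, (Polynomial.degree_smul_le _ _).trans_lt hP, rfl⟩, ?_⟩
    have e : y ^ k * ((c • f : coordSubalgebra 𝔭) : PolyRing K n) + Polynomial.aeval y (c • P)
        = (c : PolyRing K n) * (y ^ k * (f : PolyRing K n) + Polynomial.aeval y P) := by
      rw [map_smul, smul_eq_mul, Subalgebra.coe_mul, Algebra.smul_def]
      change _ + (c : PolyRing K n) * _ = _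
      ring
    rw [e]
    exact 𝔞.mul_mem_left _ hg

/-- The partial elimination ideals `𝒦_k^𝔭(𝔞)`, with `𝒦_{-1}^𝔭(𝔞) = 0`. -/
noncomputable def partialElim (𝔭 𝔞 : Ideal (PolyRing K n)) : ℤ → Ideal (coordSubalgebra 𝔭)
  | Int.ofNat k => natPEI 𝔭 𝔞 k
  | Int.negSucc _ => ⊥

/-- The ideal `(𝔞 ∩ S) + 𝔮` of `S = K[𝔭₁]`, so that `S̄ = S / ((𝔞 ∩ S) + 𝔮)`. -/
noncomputable def sumIdeal (𝔭 𝔞 : Ideal (PolyRing K n)) (𝔮 : Ideal (coordSubalgebra 𝔭)) :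
    Ideal (coordSubalgebra 𝔭) :=
  𝔞.comap (algebraMap (coordSubalgebra 𝔭) (PolyRing K n)) ⊔ 𝔮

/-- The ideal `(𝔞 ∩ S)R + 𝔮R` of `R`, so that `R̄ = R / ((𝔞 ∩ S)R + 𝔮R)`. -/
noncomputable def extIdeal (𝔭 𝔞 : Ideal (PolyRing K n)) (𝔮 : Ideal (coordSubalgebra 𝔭)) :
    Ideal (PolyRing K n) :=
  (𝔞.comap (algebraMap (coordSubalgebra 𝔭) (PolyRing K n))).map
      (algebraMap (coordSubalgebra 𝔭) (PolyRing K n))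
    ⊔ 𝔮.map (algebraMap (coordSubalgebra 𝔭) (PolyRing K n))

/-- The ideal `𝔞 + 𝔮R` of `R`. -/
noncomputable def fibreIdeal (𝔭 𝔞 : Ideal (PolyRing K n)) (𝔮 : Ideal (coordSubalgebra 𝔭)) :
    Ideal (PolyRing K n) :=
  𝔞 ⊔ 𝔮.map (algebraMap (coordSubalgebra 𝔭) (PolyRing K n))

/-- The image `𝔞̄` of `𝔞` (equivalently of `𝔞 + 𝔮R`) in `R̄ = R / ((𝔞 ∩ S)R + 𝔮R)`. -/
noncomputable def barIdeal (𝔭 𝔞 : Ideal (PolyRing K n)) (𝔮 : Ideal (coordSubalgebra 𝔭)) :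
    Ideal (PolyRing K n ⧸ extIdeal 𝔭 𝔞 𝔮) :=
  (fibreIdeal 𝔭 𝔞 𝔮).map (Ideal.Quotient.mk (extIdeal 𝔭 𝔞 𝔮))

/-- The irrelevant ideal `R̄₊` of `R̄ = R / ((𝔞 ∩ S)R + 𝔮R)`, the image of `R₊`. -/
noncomputable def barIrrelevant (𝔭 𝔞 : Ideal (PolyRing K n)) (𝔮 : Ideal (coordSubalgebra 𝔭)) :
    Ideal (PolyRing K n ⧸ extIdeal 𝔭 𝔞 𝔮) :=
  (HomogeneousIdeal.irrelevant (stdGrading K n)).toIdeal.map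
    (Ideal.Quotient.mk (extIdeal 𝔭 𝔞 𝔮))

end PEI

section Saturation

variable {A : Type*} [CommRing A]

/-- The saturation `⋃ₘ (I : 𝔪 ^ m)` of the ideal `I` with respect to the ideal `𝔪`. -/
def saturation (I 𝔪 : Ideal A) : Ideal A where
  carrier := {x | ∃ m : ℕ, ∀ z ∈ 𝔪 ^ m, x * z ∈ I}
  zero_mem' := ⟨0, fun z _ => by simp⟩
  add_mem' := by
    rintro a b ⟨i, hi⟩ ⟨j, hj⟩
    refine ⟨max i j, fun z hz => ?_⟩
    rw [add_mul]
    exact I.add_mem (hi z (Ideal.pow_le_pow_right (le_max_left i j) hz))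
      (hj z (Ideal.pow_le_pow_right (le_max_right i j) hz))
  smul_mem' := by
    rintro c x ⟨i, hi⟩
    refine ⟨i, fun z hz => ?_⟩
    rw [smul_eq_mul, mul_assoc]
    exact I.mul_mem_left c (hi z hz)

end Saturation

section HilbertMultiplicity

/-- The Hilbert function `d ↦ dim_K M_d` of a graded `K`-vector space `M = ⨁ M_d`. -/
noncomputable def hilbertFunction {K M : Type*} [Field K] [AddCommGroup M] [Module K M]
    (ℳ : ℕ → Submodule K M) (d : ℕ) : ℕ :=
  Module.finrank K (ℳ d)

/-- `P` is the Hilbert polynomial of `M = ⨁ M_d`: `P(d) = dim_K M_d` for all `d ≫ 0`. -/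
def IsHilbertPolynomial {K M : Type*} [Field K] [AddCommGroup M] [Module K M]
    (ℳ : ℕ → Submodule K M) (P : Polynomial ℚ) : Prop :=
  ∀ᶠ d : ℕ in Filter.atTop, P.eval (d : ℚ) = (hilbertFunction ℳ d : ℚ)

open Classical in
/-- The Hilbert polynomial `p_M` (which is unique if it exists). -/
noncomputable def hilbertPolynomial {K M : Type*} [Field K] [AddCommGroup M] [Module K M]
    (ℳ : ℕ → Submodule K M) : Polynomial ℚ :=
  if h : ∃ P : Polynomial ℚ, IsHilbertPolynomial ℳ P then h.choose else 0

theorem IsHilbertPolynomial.unique {K M : Type*} [Field K] [AddCommGroup M] [Module K M]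
    {ℳ : ℕ → Submodule K M} {P Q : Polynomial ℚ} (hP : IsHilbertPolynomial ℳ P)
    (hQ : IsHilbertPolynomial ℳ Q) : P = Q := by
  obtain ⟨N, hN⟩ := Filter.eventually_atTop.mp (hP.and hQ)
  refine Polynomial.eq_of_infinite_eval_eq P Q ?_
  refine ((Set.Ici_infinite N).image (f := fun d : ℕ => (d : ℚ))
    (fun _ _ _ _ h => Nat.cast_injective h)).mono ?_
  rintro _ ⟨d, hd, rfl⟩
  exact (hN d hd).1.trans (hN d hd).2.symm

open Classical in
/-- The Hilbert multiplicity `e₀(M)` of a nonzero finitely generated graded module `M = ⨁ M_d`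
over the graded `K`-algebra `A`: with `d = dim M`, it is `length M` if `d = 0`, and
`(d - 1)!` times the leading coefficient of the Hilbert polynomial of `M` if `d > 0`. -/
noncomputable def hilbertMultiplicity {K : Type*} (A : Type*) {M : Type*} [Field K] [CommRing A]
    [AddCommGroup M] [Module K M] [Module A M] (ℳ : ℕ → Submodule K M) : ℚ :=
  if Module.supportDim A M = 0 then ((Module.length A M).toNat : ℚ)
  else ((((Module.supportDim A M).unbotD 0).toNat - 1)! : ℚ) * (hilbertPolynomial ℳ).leadingCoeff

/-- The Hilbert multiplicity `e₀(A/I)` of the graded `A`-module `A/I`, where `(A/I)_d` is the image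
of `A_d`. -/
noncomputable def quotientMultiplicity {K A : Type*} [Field K] [CommRing A] [Algebra K A]
    (𝒜 : ℕ → Submodule K A) (I : Ideal A) : ℚ :=
  hilbertMultiplicity A (fun d => (𝒜 d).map (Ideal.Quotient.mkₐ K I).toLinearMap)

end HilbertMultiplicity

end PartialElimination

/-! Over an algebraically closed field `𝔭` is given by a nonzero point `a` of the affine cone. Fix a
linear form `y` with `y(a) = 1`, so that `R = S[y]`, and write `J = (𝔞 ∩ S) + 𝔮`. Forms of positive
degree in `S` vanish at `a`, hence a form of `R` that does not vanish at `a` is, up to a scalar,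
monic in `y` of degree equal to its own degree (`monic_of_eval_eq_one`). As `𝔞 ⊄ 𝔭`, the ideal `𝔞`
contains a monic `f`, and `R/𝔞` is finite over `S`.

The saturation of `𝔞 + 𝔮R` is generated modulo `JR` by one form. Since `JR` vanishes at `a` and `f`
does not, this form is nonzero at `a`, so it may be taken to be a monic `F`, of degree `e` say
(`exists_monic_generator`). Both sides of the formula are read off from `e`.

Elimination ideals: `𝒦_k(𝔞) ⊆ J` exactly when `k < e` (`natPEI_le_sumIdeal_iff`), so `k₀ = e - 1`.
For `k < e`, an element of `𝔞` of degree at most `k` in `y` is a multiple of `F` modulo `J`, hence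
zero modulo `J`. For `k = e`, take a linear form `l` of `S` that is not nilpotent modulo `J`; some
`l ^ m F` lies in `𝔞 + 𝔮R`. The determinant trick on the finite module `R/𝔞`, relative to the
polynomials of degree `< e`, produces an element of `𝒦_e(𝔞)` congruent to a power of `l` modulo `𝔮`,
and this is not in `J` (`exists_mem_of_C_mul_mem_sup`). Monotonicity of `𝒦` covers `k > e`.

Multiplicities: in large degrees `R/(𝔞 + 𝔮R)` agrees with `(S/J)[y]/(F)`, which is free over `S/J`
on `1, y, …, y ^ (e - 1)`. Both quotients have dimension one, so their multiplicities are the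
eventual values of their Hilbert functions, and these differ by the factor `e`
(`hilbertFunction_fibre`). -/

namespace PartialElimination

/-! ### The closed point as a point of the affine cone -/

section Point

variable {K : Type*} [Field K] {n : ℕ}

theorem coe_decompose (f : PolyRing K n) (d : ℕ) :
    (DirectSum.decompose (stdGrading K n) f d : PolyRing K n) =
      MvPolynomial.homogeneousComponent d f :=
  MvPolynomial.decomposition.decompose'_apply f d

theorem mem_irrelevant_iff_constantCoeff (f : PolyRing K n) :
    f ∈ (HomogeneousIdeal.irrelevant (stdGrading K n)).toIdeal ↔
      MvPolynomial.constantCoeff f = 0 := by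
  rw [HomogeneousIdeal.mem_iff, HomogeneousIdeal.mem_irrelevant_iff, GradedRing.proj_apply,
    coe_decompose, MvPolynomial.homogeneousComponent_zero, MvPolynomial.C_eq_zero,
    MvPolynomial.constantCoeff_eq]

/-- `a` is a nonzero point of the affine cone, and the homogeneous elements of `𝔭` are the forms
vanishing at `a`. -/
def IsConePoint (𝔭 : Ideal (PolyRing K n)) (a : Fin (n + 1) → K) : Prop :=
  a ≠ 0 ∧ ∀ (d : ℕ) (f : PolyRing K n), f.IsHomogeneous d → (f ∈ 𝔭 ↔ MvPolynomial.eval a f = 0)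

/-- By the Nullstellensatz, if `0` were the only zero of `𝔭`, then `𝔭` would contain `R₊`. For a
nonzero zero `a`, the homogeneous core of the ideal of `a` is a relevant homogeneous prime above
`𝔭`, hence equal to it by maximality. -/
theorem exists_isConePoint [IsAlgClosed K] (𝔭 : ProjectiveSpectrum (stdGrading K n))
    (h𝔭 : IsMax 𝔭) : ∃ a, IsConePoint 𝔭.asHomogeneousIdeal.toIdeal a := by
  obtain ⟨a, ha, ha0⟩ : ∃ a ∈ MvPolynomial.zeroLocus K 𝔭.asHomogeneousIdeal.toIdeal, a ≠ 0 := by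
    by_contra! hcon
    refine 𝔭.not_irrelevant_le fun f hf => ?_
    rw [← HomogeneousIdeal.mem_iff, mem_irrelevant_iff_constantCoeff] at hf
    rw [← HomogeneousIdeal.mem_iff, ← MvPolynomial.IsPrime.vanishingIdeal_zeroLocus (K := K)
      𝔭.asHomogeneousIdeal.toIdeal, MvPolynomial.mem_vanishingIdeal_iff]
    intro x hx
    rw [hcon x hx, MvPolynomial.aeval_zero, hf, map_zero]
  have hprime : (MvPolynomial.vanishingIdeal K ({a} : Set (Fin (n + 1) → K))).IsPrime :=
    (MvPolynomial.isMaximal_iff_eq_vanishingIdeal_singleton.mpr ⟨a, rfl⟩).isPrime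
  let 𝔪 : ProjectiveSpectrum (stdGrading K n) :=
    { asHomogeneousIdeal := (MvPolynomial.vanishingIdeal K {a}).homogeneousCore (stdGrading K n)
      isPrime := hprime.homogeneousCore
      not_irrelevant_le := by
        intro hle
        apply ha0
        funext i
        have h1 : (MvPolynomial.X i : PolyRing K n) ∈
            HomogeneousIdeal.irrelevant (stdGrading K n) := by
          rw [← HomogeneousIdeal.mem_iff, mem_irrelevant_iff_constantCoeff]
          simp
        have h2 := Ideal.toIdeal_homogeneousCore_le _ _ (hle h1)
        simpa using h2 }
  have hle : 𝔭 ≤ 𝔪 := by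
    intro f hf
    refine Ideal.homogeneousCore_mono _ (fun g hg => ?_)
      (𝔭.asHomogeneousIdeal.isHomogeneous.toIdeal_homogeneousCore_eq_self.ge hf)
    exact (MvPolynomial.mem_vanishingIdeal_singleton_iff a g).mpr (ha g hg)
  have heq : 𝔭.asHomogeneousIdeal = 𝔪.asHomogeneousIdeal := le_antisymm hle (h𝔭 hle)
  refine ⟨a, ha0, fun d f hf => ?_⟩
  rw [heq]
  constructor
  · intro h
    have h2 := Ideal.toIdeal_homogeneousCore_le _ _ h
    simpa using h2
  · intro h
    exact Ideal.mem_homogeneousCore_of_homogeneous_of_mem ⟨d, hf⟩ (by simpa using h)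

theorem eval_eq_constantCoeff {𝔭 : Ideal (PolyRing K n)} {a : Fin (n + 1) → K}
    (ha : IsConePoint 𝔭 a) (f : coordSubalgebra 𝔭) :
    MvPolynomial.eval a (f : PolyRing K n) = MvPolynomial.constantCoeff (f : PolyRing K n) := by
  obtain ⟨f, hf⟩ := f
  induction hf using Algebra.adjoin_induction with
  | mem x hx =>
    rw [(ha.2 1 x hx.2).mp hx.1, MvPolynomial.constantCoeff_eq,
      MvPolynomial.IsHomogeneous.coeff_eq_zero hx.2 (by simp)]
  | algebraMap r => simp
  | add x y _ _ hx hy => simpa using congrArg₂ (· + ·) hx hy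
  | mul x y _ _ hx hy => simpa using congrArg₂ (· * ·) hx hy

end Point

/-! ### The polynomial ring structure `R = S[y]` and its grading -/

section Expansion

variable {K : Type*} [Field K] {n : ℕ} {𝔭 : Ideal (PolyRing K n)} {a : Fin (n + 1) → K}
  {y : PolyRing K n}

theorem exists_linear_eval_eq_one (ha : IsConePoint 𝔭 a) :
    ∃ y : PolyRing K n, y.IsHomogeneous 1 ∧ MvPolynomial.eval a y = 1 := by
  obtain ⟨j, hj⟩ := Function.ne_iff.mp ha.1
  exact ⟨MvPolynomial.C (a j)⁻¹ * MvPolynomial.X j, MvPolynomial.isHomogeneous_C_mul_X _ _,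
    by simpa using inv_mul_cancel₀ hj⟩

theorem sub_smul_mem_linearForms (ha : IsConePoint 𝔭 a) (hy : y.IsHomogeneous 1)
    (hya : MvPolynomial.eval a y = 1) {x : PolyRing K n} (hx : x.IsHomogeneous 1) :
    x - MvPolynomial.C (MvPolynomial.eval a x) * y ∈ linearForms 𝔭 := by
  have h : (x - MvPolynomial.C (MvPolynomial.eval a x) * y).IsHomogeneous 1 :=
    hx.sub (hy.C_mul _)
  exact ⟨(ha.2 1 _ h).mpr (by simp [hya]), h⟩

/-- The substitution `X_i ↦ X_i + a_i (T - y)`, with a new variable `T`. -/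
noncomputable def shiftHom (a : Fin (n + 1) → K) (y : PolyRing K n) :
    PolyRing K n →ₐ[K] Polynomial (PolyRing K n) :=
  MvPolynomial.aeval fun i =>
    Polynomial.C (MvPolynomial.X i - MvPolynomial.C (a i) * y)
      + Polynomial.C (MvPolynomial.C (a i)) * Polynomial.X

theorem shiftHom_linear {x : PolyRing K n} (hx : x.IsHomogeneous 1) :
    shiftHom a y x = Polynomial.C (x - MvPolynomial.C (MvPolynomial.eval a x) * y)
      + Polynomial.C (MvPolynomial.C (MvPolynomial.eval a x)) * Polynomial.X := by
  replace hx : x ∈ MvPolynomial.homogeneousSubmodule (Fin (n + 1)) K 1 := hx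
  rw [MvPolynomial.homogeneousSubmodule_one_eq_span_X] at hx
  induction hx using Submodule.span_induction with
  | mem x hx =>
    obtain ⟨i, rfl⟩ := hx
    simp [shiftHom]
  | zero => simp
  | add u v _ _ hu hv => rw [map_add, hu, hv]; simp only [map_add, map_sub, map_mul]; ring
  | smul c u _ hu =>
    rw [map_smul, hu, Algebra.smul_def, IsScalarTower.algebraMap_apply K (PolyRing K n),
      MvPolynomial.smul_eq_C_mul]
    simp only [map_sub, map_mul, MvPolynomial.eval_C, MvPolynomial.algebraMap_eq,
      Polynomial.algebraMap_eq]
    ring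

/-- Translation in the direction `a` does not change a linear form that vanishes at `a`. -/
theorem shiftHom_coe (ha : IsConePoint 𝔭 a) (f : coordSubalgebra 𝔭) :
    shiftHom a y (f : PolyRing K n) = Polynomial.C (f : PolyRing K n) := by
  obtain ⟨f, hf⟩ := f
  induction hf using Algebra.adjoin_induction with
  | mem x hx =>
    rw [shiftHom_linear hx.2, (ha.2 1 x hx.2).mp hx.1]
    simp
  | algebraMap r =>
    rw [AlgHom.commutes]
    rfl
  | add u v _ _ hu hv => simpa using congrArg₂ (· + ·) hu hv
  | mul u v _ _ hu hv => simpa using congrArg₂ (· * ·) hu hv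

/-- `shiftHom` sends `y` to the new variable and fixes `S`, so it recovers the coefficients of an
expansion in `y`. This gives the uniqueness of such expansions. -/
theorem shiftHom_aeval (ha : IsConePoint 𝔭 a) (hy : y.IsHomogeneous 1)
    (hya : MvPolynomial.eval a y = 1) (P : Polynomial (coordSubalgebra 𝔭)) :
    shiftHom a y (Polynomial.aeval y P) =
      P.map (algebraMap (coordSubalgebra 𝔭) (PolyRing K n)) := by
  induction P using Polynomial.induction_on' with
  | add p q hp hq => rw [map_add, map_add, hp, hq, Polynomial.map_add]
  | monomial i s =>
    rw [Polynomial.aeval_monomial, map_mul, map_pow, shiftHom_linear hy, hya,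
      Polynomial.map_monomial, ← Polynomial.C_mul_X_pow_eq_monomial]
    change shiftHom a y (s : PolyRing K n) * _ = _
    rw [shiftHom_coe ha]
    simp

theorem aeval_bijective (ha : IsConePoint 𝔭 a) (hy : y.IsHomogeneous 1)
    (hya : MvPolynomial.eval a y = 1) :
    Function.Bijective
      (Polynomial.aeval y : Polynomial (coordSubalgebra 𝔭) →ₐ[coordSubalgebra 𝔭] PolyRing K n) := by
  constructor
  · intro P Q hPQ
    refine Polynomial.map_injective (algebraMap (coordSubalgebra 𝔭) (PolyRing K n))
      Subtype.val_injective ?_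
    rw [← shiftHom_aeval ha hy hya, ← shiftHom_aeval ha hy hya, hPQ]
  · have key : ((Polynomial.aeval y : Polynomial (coordSubalgebra 𝔭) →ₐ[coordSubalgebra 𝔭]
        PolyRing K n).restrictScalars K).range = ⊤ := by
      rw [eq_top_iff, ← MvPolynomial.adjoin_range_X, Algebra.adjoin_le_iff]
      rintro _ ⟨i, rfl⟩
      -- `X_i = (X_i - a_i y) + a_i y`, and the first summand vanishes at `a`.
      refine ⟨Polynomial.C ⟨_, Algebra.subset_adjoin (sub_smul_mem_linearForms ha hy hya
        (MvPolynomial.isHomogeneous_X K i))⟩ +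
          Polynomial.C (algebraMap K _ (a i)) * Polynomial.X, ?_⟩
      change Polynomial.aeval y _ = _
      rw [map_add, map_mul, Polynomial.aeval_C, Polynomial.aeval_C, Polynomial.aeval_X]
      change (MvPolynomial.X i - _) + MvPolynomial.C (a i) * y = _
      simp
    intro r
    exact (key ▸ Algebra.mem_top : r ∈ _)

theorem mem_subGrading_one_iff (ha : IsConePoint 𝔭 a) (f : coordSubalgebra 𝔭) :
    f ∈ subGrading 𝔭 1 ↔ (f : PolyRing K n) ∈ linearForms 𝔭 := by
  refine ⟨fun h => ⟨(ha.2 1 _ h).mpr ?_, h⟩, fun h => h.2⟩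
  exact (eval_eq_constantCoeff ha f).trans
    (MvPolynomial.IsHomogeneous.coeff_eq_zero h (by simp))

/-- Setting the new variable of `shiftHom` to `0` gives a retraction `ψ` of `R` onto `S` with `ψ(y)
= 0`. It carries `R_d = R_1 ^ d` into `S_1 ^ d` and fixes `S_d`. -/
theorem subGrading_one_pow (ha : IsConePoint 𝔭 a) (hy : y.IsHomogeneous 1)
    (hya : MvPolynomial.eval a y = 1) (d : ℕ) : subGrading 𝔭 d ≤ subGrading 𝔭 1 ^ d := by
  intro s hs
  have hmap : (subGrading 𝔭 1).map (coordSubalgebra 𝔭).val.toLinearMap = linearForms 𝔭 := by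
    ext x
    constructor
    · rintro ⟨f, hf, rfl⟩
      exact (mem_subGrading_one_iff ha f).mp hf
    · intro hx
      exact ⟨⟨x, Algebra.subset_adjoin hx⟩, hx.2, rfl⟩
  let ψ : PolyRing K n →ₐ[K] PolyRing K n :=
    (Polynomial.aeval (0 : PolyRing K n)).restrictScalars K |>.comp (shiftHom a y)
  have hψ : ψ (s : PolyRing K n) = s := by
    change Polynomial.aeval (0 : PolyRing K n) (shiftHom a y (s : PolyRing K n)) = _
    rw [shiftHom_coe ha, Polynomial.aeval_C]
    rfl
  have h1 : (s : PolyRing K n) ∈ linearForms 𝔭 ^ d := by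
    rw [← hψ]
    have h2 : (s : PolyRing K n) ∈ MvPolynomial.homogeneousSubmodule (Fin (n + 1)) K 1 ^ d := by
      rw [MvPolynomial.homogeneousSubmodule_one_pow]
      exact hs
    have h3 := Submodule.mem_map_of_mem (f := ψ.toLinearMap) h2
    rw [Submodule.map_pow] at h3
    refine (pow_le_pow_left' ?_ d : _ ≤ linearForms 𝔭 ^ d) h3
    rintro _ ⟨x, hx, rfl⟩
    change Polynomial.aeval (0 : PolyRing K n) (shiftHom a y x) ∈ _
    rw [shiftHom_linear hx]
    simpa using sub_smul_mem_linearForms ha hy hya hx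
  rw [← hmap, ← Submodule.map_pow] at h1
  obtain ⟨s', hs', h⟩ := h1
  rwa [← Subtype.val_injective h]

theorem exists_algebraMap_eq_of_mem_subGrading_zero {s : coordSubalgebra 𝔭}
    (hs : s ∈ subGrading 𝔭 0) : ∃ c : K, algebraMap K (coordSubalgebra 𝔭) c = s := by
  replace hs : (s : PolyRing K n) ∈ MvPolynomial.homogeneousSubmodule (Fin (n + 1)) K 0 := hs
  rw [MvPolynomial.homogeneousSubmodule_zero] at hs
  obtain ⟨c, hc⟩ := Submodule.mem_one.mp hs
  exact ⟨c, Subtype.val_injective hc⟩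

/-- The homogeneous component of degree `d` of a polynomial in `y` over `S`, where `y` has
degree `1`. -/
noncomputable def polyComponent (d : ℕ) (P : Polynomial (coordSubalgebra 𝔭)) :
    Polynomial (coordSubalgebra 𝔭) :=
  ∑ i ∈ Finset.range (d + 1), Polynomial.monomial i
    ⟨MvPolynomial.homogeneousComponent (d - i) (P.coeff i : PolyRing K n),
      homogeneousComponent_mem 𝔭 (P.coeff i).2 _⟩

theorem coeff_polyComponent (d i : ℕ) (P : Polynomial (coordSubalgebra 𝔭)) :
    ((polyComponent d P).coeff i : PolyRing K n) =
      if i ≤ d then MvPolynomial.homogeneousComponent (d - i) (P.coeff i : PolyRing K n) else 0 := by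
  rw [polyComponent, Polynomial.finsetSum_coeff]
  simp only [Polynomial.coeff_monomial, Finset.sum_ite_eq', Finset.mem_range, Nat.lt_succ_iff]
  split_ifs <;> rfl

theorem homogeneousComponent_mul_pow (hy : y.IsHomogeneous 1) (r : PolyRing K n) (d i : ℕ) :
    MvPolynomial.homogeneousComponent d (r * y ^ i) =
      if i ≤ d then MvPolynomial.homogeneousComponent (d - i) r * y ^ i else 0 := by
  have h : y ^ i ∈ stdGrading K n i := by
    have := hy.pow i
    rwa [one_mul] at this
  rw [← coe_decompose, ← coe_decompose, DirectSum.coe_decompose_mul_of_right_mem _ d h]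

theorem homogeneousComponent_aeval (hy : y.IsHomogeneous 1) (d : ℕ)
    (P : Polynomial (coordSubalgebra 𝔭)) :
    MvPolynomial.homogeneousComponent d (Polynomial.aeval y P) =
      Polynomial.aeval y (polyComponent d P) := by
  have hsm : ∀ (s : coordSubalgebra 𝔭) (r : PolyRing K n), s • r = (s : PolyRing K n) * r :=
    fun _ _ => rfl
  rw [Polynomial.aeval_eq_sum_range' (n := max (d + 1) (P.natDegree + 1)) (by omega), map_sum,
    Polynomial.aeval_eq_sum_range' (n := max (d + 1) (P.natDegree + 1))]
  · refine Finset.sum_congr rfl fun i _ => ?_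
    rw [hsm, hsm, coeff_polyComponent, homogeneousComponent_mul_pow hy]
    split_ifs <;> simp
  · refine lt_max_of_lt_left (Nat.lt_succ_of_le ?_)
    refine Polynomial.natDegree_le_iff_coeff_eq_zero.mpr fun i hi => ?_
    apply Subtype.val_injective
    rw [coeff_polyComponent, if_neg (by omega)]
    rfl

theorem polyComponent_eq_self (ha : IsConePoint 𝔭 a) (hy : y.IsHomogeneous 1)
    (hya : MvPolynomial.eval a y = 1) {d : ℕ} {P : Polynomial (coordSubalgebra 𝔭)}
    (hP : (Polynomial.aeval y P).IsHomogeneous d) : polyComponent d P = P := by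
  apply (aeval_bijective ha hy hya).1
  rw [← homogeneousComponent_aeval hy, MvPolynomial.homogeneousComponent_eq_self hP]

theorem coeff_mem_subGrading (ha : IsConePoint 𝔭 a) (hy : y.IsHomogeneous 1)
    (hya : MvPolynomial.eval a y = 1) {d : ℕ} {P : Polynomial (coordSubalgebra 𝔭)}
    (hP : (Polynomial.aeval y P).IsHomogeneous d) {i : ℕ} (hi : i ≤ d) :
    P.coeff i ∈ subGrading 𝔭 (d - i) := by
  have h := coeff_polyComponent d i P
  rw [polyComponent_eq_self ha hy hya hP, if_pos hi] at h
  rw [mem_subGrading, h]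
  exact MvPolynomial.homogeneousComponent_isHomogeneous _ _

theorem natDegree_le_of_isHomogeneous (ha : IsConePoint 𝔭 a) (hy : y.IsHomogeneous 1)
    (hya : MvPolynomial.eval a y = 1) {d : ℕ} {P : Polynomial (coordSubalgebra 𝔭)}
    (hP : (Polynomial.aeval y P).IsHomogeneous d) : P.natDegree ≤ d := by
  refine Polynomial.natDegree_le_iff_coeff_eq_zero.mpr fun i hi => ?_
  apply Subtype.val_injective
  rw [← polyComponent_eq_self ha hy hya hP, coeff_polyComponent, if_neg (by omega)]
  rfl

theorem eval_aeval (ha : IsConePoint 𝔭 a) (hya : MvPolynomial.eval a y = 1)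
    (P : Polynomial (coordSubalgebra 𝔭)) :
    MvPolynomial.eval a (Polynomial.aeval y P) =
      MvPolynomial.constantCoeff ((P.eval 1 : coordSubalgebra 𝔭) : PolyRing K n) := by
  induction P using Polynomial.induction_on' with
  | add p q hp hq => simp [hp, hq]
  | monomial i s =>
    rw [Polynomial.aeval_monomial, map_mul, map_pow, hya, one_pow, mul_one,
      Polynomial.eval_monomial, one_pow, mul_one]
    exact eval_eq_constantCoeff ha s

/-- A form of degree `d` with value `1` at `a` is a monic polynomial of degree `d` in `y`. -/
theorem monic_of_eval_eq_one (ha : IsConePoint 𝔭 a) (hy : y.IsHomogeneous 1)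
    (hya : MvPolynomial.eval a y = 1) {d : ℕ} {P : Polynomial (coordSubalgebra 𝔭)}
    (hP : (Polynomial.aeval y P).IsHomogeneous d)
    (h1 : MvPolynomial.eval a (Polynomial.aeval y P) = 1) : P.Monic ∧ P.natDegree = d := by
  have hle := natDegree_le_of_isHomogeneous ha hy hya hP
  have hcoeff : P.coeff d = 1 := by
    have hd := coeff_mem_subGrading ha hy hya hP le_rfl
    rw [Nat.sub_self] at hd
    obtain ⟨c, hc⟩ := exists_algebraMap_eq_of_mem_subGrading_zero hd
    -- The coefficients at `y ^ i` with `i < d` have positive degree, so only the constant at `y ^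
    -- d` contributes to the value at `a`.
    rw [eval_aeval ha hya, Polynomial.eval_eq_sum_range' (Nat.lt_succ_of_le hle),
      Finset.sum_range_succ, Subalgebra.coe_add, AddSubmonoidClass.coe_finsetSum, map_add,
      map_sum, Finset.sum_eq_zero, zero_add, one_pow, mul_one, ← hc] at h1
    · rw [← hc]
      have : c = 1 := by simpa using h1
      rw [this, map_one]
    · intro i hi
      rw [Finset.mem_range] at hi
      rw [one_pow, mul_one, MvPolynomial.constantCoeff_eq]
      refine MvPolynomial.IsHomogeneous.coeff_eq_zero
        (mem_subGrading.mp (coeff_mem_subGrading ha hy hya hP hi.le)) ?_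
      rw [map_zero]
      omega
  have hdeg : P.natDegree = d :=
    le_antisymm hle (Polynomial.le_natDegree_of_ne_zero (by rw [hcoeff]; exact one_ne_zero))
  refine ⟨?_, hdeg⟩
  rw [Polynomial.Monic, Polynomial.leadingCoeff, hdeg, hcoeff]

end Expansion

/-! ### Independence of `y`, and homogeneity of the ideals involved -/

section Homogeneity

variable {K : Type*} [Field K] {n : ℕ} {𝔭 : Ideal (PolyRing K n)} {a : Fin (n + 1) → K}
  {y : PolyRing K n}

/-- One `y` suffices. Any other admissible `z` satisfies `z = c y + l` with `c = z(a) ≠ 0` and `l ∈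
S_1`; substituting `y = c⁻¹ z - c⁻¹ l` scales the coefficient of degree `k` by `c⁻¹ ^ k`, which the
factor `c ^ k` undoes. -/
theorem mem_natPEI_iff (ha : IsConePoint 𝔭 a) (hy : y.IsHomogeneous 1)
    (hya : MvPolynomial.eval a y = 1) (𝔞 : Ideal (PolyRing K n)) (k : ℕ)
    (f : coordSubalgebra 𝔭) :
    f ∈ natPEI 𝔭 𝔞 k ↔ ∃ P : Polynomial (coordSubalgebra 𝔭),
      P.natDegree ≤ k ∧ P.coeff k = f ∧ Polynomial.aeval y P ∈ 𝔞 := by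
  constructor
  · intro hf
    have hy𝔭 : y ∉ linearForms 𝔭 := fun h => by
      rw [(ha.2 1 y hy).mp h.1] at hya
      exact zero_ne_one hya
    obtain ⟨g, ⟨P, hP, rfl⟩, hg⟩ := hf y hy hy𝔭
    refine ⟨Polynomial.monomial k f + P, ?_, ?_, ?_⟩
    · refine (Polynomial.natDegree_add_le _ _).trans (max_le (Polynomial.natDegree_monomial_le _) ?_)
      exact Polynomial.natDegree_le_of_degree_le hP.le
    · rw [Polynomial.coeff_add, Polynomial.coeff_monomial, if_pos rfl,
        Polynomial.coeff_eq_zero_of_degree_lt hP, add_zero]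
    · rw [map_add, Polynomial.aeval_monomial, mul_comm]
      exact hg
  · rintro ⟨P, hPk, rfl, hP⟩ z hz hz𝔭
    set c := MvPolynomial.eval a z with hc
    have hc0 : c ≠ 0 := fun h => hz𝔭 ⟨(ha.2 1 z hz).mpr h, hz⟩
    let l : coordSubalgebra 𝔭 :=
      ⟨z - MvPolynomial.C c * y, Algebra.subset_adjoin (sub_smul_mem_linearForms ha hy hya hz)⟩
    let b : coordSubalgebra 𝔭 := algebraMap K _ c⁻¹
    let b' : coordSubalgebra 𝔭 := algebraMap K _ c
    have hbb : b' * b = 1 := by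
      rw [← map_mul, mul_inv_cancel₀ hc0, map_one]
    let q : Polynomial (coordSubalgebra 𝔭) := Polynomial.C b * Polynomial.X + Polynomial.C (-(b * l))
    have hq : Polynomial.aeval z q = y := by
      simp only [q, map_add, map_mul, Polynomial.aeval_C, Polynomial.aeval_X]
      change MvPolynomial.C c⁻¹ * z + -(MvPolynomial.C c⁻¹ * (z - MvPolynomial.C c * y)) = y
      have : (MvPolynomial.C c⁻¹ * MvPolynomial.C c : PolyRing K n) = 1 := by
        rw [← map_mul, inv_mul_cancel₀ hc0, map_one]
      linear_combination y * this
    have hq1 : q.natDegree ≤ 1 := Polynomial.natDegree_linear_le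
    have hqc : q.coeff 1 = b := by simp [q]
    set Q := Polynomial.C (b' ^ k) * P.comp q with hQ
    have hQa : Polynomial.aeval z Q ∈ 𝔞 := by
      rw [hQ, map_mul, Polynomial.aeval_comp, hq]
      exact 𝔞.mul_mem_left _ hP
    have hQd : Q.natDegree ≤ k := by
      refine (Polynomial.natDegree_C_mul_le _ _).trans (Polynomial.natDegree_comp_le.trans ?_)
      calc P.natDegree * q.natDegree ≤ k * 1 := Nat.mul_le_mul hPk hq1
        _ = k := mul_one k
    have hQc : Q.coeff k = P.coeff k := by
      have h1 : (P.comp q).coeff k = P.coeff k * b ^ k := by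
        rw [Polynomial.comp, Polynomial.eval₂_eq_sum_range' _ (Nat.lt_succ_of_le hPk),
          Finset.sum_range_succ, Polynomial.coeff_add, Polynomial.finsetSum_coeff,
          Finset.sum_eq_zero, zero_add, Polynomial.coeff_C_mul]
        · have h2 := Polynomial.coeff_pow_of_natDegree_le (m := k) hq1
          rw [mul_one, hqc] at h2
          rw [h2]
        · intro i hi
          rw [Finset.mem_range] at hi
          have h3 : (q ^ i).natDegree < k :=
            (Polynomial.natDegree_pow_le_of_le i hq1).trans_lt (by omega)
          rw [Polynomial.coeff_C_mul, Polynomial.coeff_eq_zero_of_natDegree_lt h3, mul_zero]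
      rw [hQ, Polynomial.coeff_C_mul, h1, mul_left_comm, ← mul_pow, hbb, one_pow, mul_one]
    refine ⟨Polynomial.aeval z (Q.erase k), ⟨_, ?_, rfl⟩, ?_⟩
    · rw [Polynomial.degree_lt_iff_coeff_zero]
      intro i hi
      rw [Polynomial.coeff_erase]
      split_ifs with hik
      · rfl
      · exact Polynomial.coeff_eq_zero_of_natDegree_lt (by omega)
    · have hm : Polynomial.aeval z (Polynomial.monomial k (Q.coeff k)) =
          (P.coeff k : PolyRing K n) * z ^ k := by
        rw [Polynomial.aeval_monomial, hQc]
        rfl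
      rw [mul_comm, ← hm, ← map_add, Polynomial.monomial_add_erase]
      exact hQa

theorem coe_decompose_subGrading (f : coordSubalgebra 𝔭) (d : ℕ) :
    ((DirectSum.decompose (subGrading 𝔭) f d : coordSubalgebra 𝔭) : PolyRing K n) =
      MvPolynomial.homogeneousComponent d (f : PolyRing K n) := by
  classical
  conv_rhs => rw [← DirectSum.sum_support_decompose (subGrading 𝔭) f]
  rw [AddSubmonoidClass.coe_finsetSum, map_sum]
  have h : ∀ i, MvPolynomial.homogeneousComponent d
      ((DirectSum.decompose (subGrading 𝔭) f i : coordSubalgebra 𝔭) : PolyRing K n) =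
      if d = i then ((DirectSum.decompose (subGrading 𝔭) f i : coordSubalgebra 𝔭) : PolyRing K n)
        else 0 := by
    intro i
    have := MvPolynomial.homogeneousComponent_of_mem (m := d) (n := i)
      (p := ((DirectSum.decompose (subGrading 𝔭) f i : coordSubalgebra 𝔭) : PolyRing K n))
      (mem_subGrading.mp (DirectSum.decompose (subGrading 𝔭) f i).2)
    simpa [eq_comm] using this
  simp only [h, Finset.sum_ite_eq]
  split_ifs with hd
  · rfl
  · rw [DFinsupp.notMem_support_iff] at hd
    rw [hd]
    rfl

theorem homogeneousComponent_mem_ideal {I : Ideal (coordSubalgebra 𝔭)}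
    (hI : I.IsHomogeneous (subGrading 𝔭)) {f : coordSubalgebra 𝔭} (hf : f ∈ I) (d : ℕ) :
    (⟨MvPolynomial.homogeneousComponent d (f : PolyRing K n),
      homogeneousComponent_mem 𝔭 f.2 d⟩ : coordSubalgebra 𝔭) ∈ I := by
  convert! hI d hf using 1
  exact Subtype.ext (coe_decompose_subGrading f d).symm

theorem sumIdeal_isHomogeneous {𝔞 : Ideal (PolyRing K n)} (h𝔞 : 𝔞.IsHomogeneous (stdGrading K n))
    {𝔮 : Ideal (coordSubalgebra 𝔭)} (h𝔮 : 𝔮.IsHomogeneous (subGrading 𝔭)) :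
    (sumIdeal 𝔭 𝔞 𝔮).IsHomogeneous (subGrading 𝔭) := by
  refine Ideal.IsHomogeneous.sup (fun d f hf => ?_) h𝔮
  rw [Ideal.mem_comap] at hf ⊢
  change ((DirectSum.decompose (subGrading 𝔭) f d : coordSubalgebra 𝔭) : PolyRing K n) ∈ 𝔞
  rw [coe_decompose_subGrading]
  exact MvPolynomial.homogeneousComponent_mem_of_mem h𝔞 hf d

theorem aeval_mem_map_iff (ha : IsConePoint 𝔭 a) (hy : y.IsHomogeneous 1)
    (hya : MvPolynomial.eval a y = 1) (I : Ideal (coordSubalgebra 𝔭))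
    (P : Polynomial (coordSubalgebra 𝔭)) :
    Polynomial.aeval y P ∈ I.map (algebraMap (coordSubalgebra 𝔭) (PolyRing K n)) ↔
      ∀ i, P.coeff i ∈ I := by
  let E := RingEquiv.ofBijective _ (aeval_bijective ha hy hya)
  have h1 : algebraMap (coordSubalgebra 𝔭) (PolyRing K n) =
      (E : Polynomial (coordSubalgebra 𝔭) →+* PolyRing K n).comp Polynomial.C := by
    ext s : 1
    exact (Polynomial.aeval_C y s).symm
  rw [h1, ← Ideal.map_map, ← Ideal.mem_map_C_iff]
  change E P ∈ Ideal.map (E : Polynomial (coordSubalgebra 𝔭) →+* PolyRing K n) _ ↔ _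
  constructor
  · intro h
    obtain ⟨Q, hQ, hQP⟩ := (Ideal.mem_map_iff_of_surjective _ E.surjective).mp h
    rwa [← E.injective hQP]
  · exact Ideal.mem_map_of_mem _

theorem map_isHomogeneous (ha : IsConePoint 𝔭 a) (hy : y.IsHomogeneous 1)
    (hya : MvPolynomial.eval a y = 1) {I : Ideal (coordSubalgebra 𝔭)}
    (hI : I.IsHomogeneous (subGrading 𝔭)) :
    (I.map (algebraMap (coordSubalgebra 𝔭) (PolyRing K n))).IsHomogeneous (stdGrading K n) := by
  intro d r hr
  obtain ⟨P, rfl⟩ := (aeval_bijective ha hy hya).2 r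
  rw [coe_decompose, homogeneousComponent_aeval hy]
  rw [aeval_mem_map_iff ha hy hya] at hr ⊢
  intro i
  by_cases hi : i ≤ d
  · convert! homogeneousComponent_mem_ideal hI (hr i) (d - i) using 1
    apply Subtype.ext
    rw [coeff_polyComponent, if_pos hi]
  · convert! I.zero_mem using 1
    apply Subtype.ext
    rw [coeff_polyComponent, if_neg hi]
    rfl

theorem extIdeal_eq_map (𝔞 : Ideal (PolyRing K n)) (𝔮 : Ideal (coordSubalgebra 𝔭)) :
    extIdeal 𝔭 𝔞 𝔮 =
      (sumIdeal 𝔭 𝔞 𝔮).map (algebraMap (coordSubalgebra 𝔭) (PolyRing K n)) :=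
  (Ideal.map_sup _ _ _).symm

theorem extIdeal_le_fibreIdeal (𝔞 : Ideal (PolyRing K n)) (𝔮 : Ideal (coordSubalgebra 𝔭)) :
    extIdeal 𝔭 𝔞 𝔮 ≤ fibreIdeal 𝔭 𝔞 𝔮 :=
  sup_le_sup_right Ideal.map_comap_le _

theorem fibreIdeal_isHomogeneous (ha : IsConePoint 𝔭 a) (hy : y.IsHomogeneous 1)
    (hya : MvPolynomial.eval a y = 1) {𝔞 : Ideal (PolyRing K n)}
    (h𝔞 : 𝔞.IsHomogeneous (stdGrading K n)) {𝔮 : Ideal (coordSubalgebra 𝔭)}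
    (h𝔮 : 𝔮.IsHomogeneous (subGrading 𝔭)) :
    (fibreIdeal 𝔭 𝔞 𝔮).IsHomogeneous (stdGrading K n) :=
  h𝔞.sup (map_isHomogeneous ha hy hya h𝔮)

theorem constantCoeff_eq_zero_of_mem {I : Ideal (coordSubalgebra 𝔭)}
    (hI : I.IsHomogeneous (subGrading 𝔭)) (htop : I ≠ ⊤) {s : coordSubalgebra 𝔭} (hs : s ∈ I) :
    MvPolynomial.constantCoeff (s : PolyRing K n) = 0 := by
  by_contra hne
  refine htop (I.eq_top_of_isUnit_mem (homogeneousComponent_mem_ideal hI hs 0) ?_)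
  have h : (⟨MvPolynomial.homogeneousComponent 0 (s : PolyRing K n),
      homogeneousComponent_mem 𝔭 s.2 0⟩ : coordSubalgebra 𝔭) =
      algebraMap K _ (MvPolynomial.constantCoeff (s : PolyRing K n)) :=
    Subtype.ext (MvPolynomial.homogeneousComponent_zero _)
  rw [h]
  exact (IsUnit.mk0 _ hne).map _

/-- The coefficients of `r` in `y` lie in a proper homogeneous ideal, so they have no constant term
and vanish at `a`. -/
theorem eval_eq_zero_of_mem_map (ha : IsConePoint 𝔭 a) (hy : y.IsHomogeneous 1)
    (hya : MvPolynomial.eval a y = 1) {I : Ideal (coordSubalgebra 𝔭)}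
    (hI : I.IsHomogeneous (subGrading 𝔭)) (htop : I ≠ ⊤) {r : PolyRing K n}
    (hr : r ∈ I.map (algebraMap (coordSubalgebra 𝔭) (PolyRing K n))) :
    MvPolynomial.eval a r = 0 := by
  obtain ⟨P, rfl⟩ := (aeval_bijective ha hy hya).2 r
  rw [aeval_mem_map_iff ha hy hya] at hr
  rw [eval_aeval ha hya]
  refine constantCoeff_eq_zero_of_mem hI htop ?_
  rw [Polynomial.eval_eq_sum_range]
  exact sum_mem fun i _ => I.mul_mem_right _ (hr i)

end Homogeneity

/-! ### Saturation and homogeneous generators -/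

section Saturation

variable {K : Type*} [Field K] {n : ℕ}

theorem homogeneousComponent_mul (g f : PolyRing K n) (d : ℕ) :
    MvPolynomial.homogeneousComponent d (g * f) = ∑ j ∈ Finset.range (d + 1),
      MvPolynomial.homogeneousComponent (d - j) g * MvPolynomial.homogeneousComponent j f := by
  have hf : f = ∑ j ∈ Finset.range (max (d + 1) (f.totalDegree + 1)),
      MvPolynomial.homogeneousComponent j f := by
    conv_lhs => rw [← MvPolynomial.sum_homogeneousComponent f]
    refine Finset.sum_subset (Finset.range_mono (le_max_right _ _)) fun j _ hj => ?_
    exact MvPolynomial.homogeneousComponent_eq_zero _ _ (by simpa using hj)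
  conv_lhs => rw [hf, Finset.mul_sum, map_sum]
  have h : ∀ j, MvPolynomial.homogeneousComponent d (g * MvPolynomial.homogeneousComponent j f) =
      if j ≤ d then MvPolynomial.homogeneousComponent (d - j) g *
        MvPolynomial.homogeneousComponent j f else 0 := by
    intro j
    have hj : MvPolynomial.homogeneousComponent j f ∈ stdGrading K n j :=
      MvPolynomial.homogeneousComponent_isHomogeneous j f
    rw [← coe_decompose, ← coe_decompose _ (d - j),
      DirectSum.coe_decompose_mul_of_right_mem _ d hj]
  simp only [h]
  rw [← Finset.sum_filter]
  refine Finset.sum_congr ?_ fun _ _ => rfl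
  ext j
  simp only [Finset.mem_filter, Finset.mem_range]
  omega

theorem homogeneousComponent_mul_of_isHomogeneous {g f : PolyRing K n} {e : ℕ}
    (hf : f.IsHomogeneous e) (d : ℕ) :
    MvPolynomial.homogeneousComponent (d + e) (g * f) =
      MvPolynomial.homogeneousComponent d g * f := by
  rw [← coe_decompose, ← coe_decompose,
    DirectSum.coe_decompose_mul_of_right_mem_of_le _ hf (Nat.le_add_left e d), Nat.add_sub_cancel]

theorem homogeneousComponent_mem_saturation {I : Ideal (PolyRing K n)}
    (hI : I.IsHomogeneous (stdGrading K n)) {r : PolyRing K n}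
    (hr : r ∈ saturation I (HomogeneousIdeal.irrelevant (stdGrading K n)).toIdeal) (d : ℕ) :
    MvPolynomial.homogeneousComponent d r ∈
      saturation I (HomogeneousIdeal.irrelevant (stdGrading K n)).toIdeal := by
  obtain ⟨m, hm⟩ := hr
  refine ⟨m, fun z hz => ?_⟩
  have hpow : ((HomogeneousIdeal.irrelevant (stdGrading K n)).toIdeal ^ m).IsHomogeneous
      (stdGrading K n) := by
    clear hm hz
    induction m with
    | zero =>
      rw [pow_zero, Ideal.one_eq_top]
      exact Ideal.IsHomogeneous.top _
    | succ m ih =>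
      rw [pow_succ]
      exact ih.mul (HomogeneousIdeal.irrelevant (stdGrading K n)).isHomogeneous
  rw [← MvPolynomial.sum_homogeneousComponent z, Finset.mul_sum]
  refine sum_mem fun j _ => ?_
  -- For a form `z_j` of degree `j`, the product `r_d z_j` is the component of `r z_j` of degree `d
  -- + j`.
  rw [← homogeneousComponent_mul_of_isHomogeneous
    (MvPolynomial.homogeneousComponent_isHomogeneous j z)]
  exact MvPolynomial.homogeneousComponent_mem_of_mem hI
    (hm _ (MvPolynomial.homogeneousComponent_mem_of_mem hpow hz j)) _

theorem mk_mem_saturation_iff {A : Type*} [CommRing A] {E I 𝔪 : Ideal A} (hEI : E ≤ I) (x : A) :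
    Ideal.Quotient.mk E x ∈ saturation (I.map (Ideal.Quotient.mk E)) (𝔪.map (Ideal.Quotient.mk E)) ↔
      x ∈ saturation I 𝔪 := by
  have hmem : ∀ z, Ideal.Quotient.mk E z ∈ I.map (Ideal.Quotient.mk E) ↔ z ∈ I :=
    fun z => Ideal.mem_quotient_iff_mem hEI
  refine exists_congr fun m => ?_
  rw [← Ideal.map_pow]
  constructor
  · intro h z hz
    rw [← hmem, map_mul]
    exact h _ (Ideal.mem_map_of_mem _ hz)
  · intro h z hz
    obtain ⟨w, hw, rfl⟩ := (Ideal.mem_map_iff_of_surjective _ Ideal.Quotient.mk_surjective).mp hz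
    rw [← map_mul, hmem]
    exact h w hw

theorem le_saturation {A : Type*} [CommRing A] (I 𝔪 : Ideal A) : I ≤ saturation I 𝔪 :=
  fun _ hx => ⟨0, fun _ _ => I.mul_mem_right _ hx⟩

theorem exists_generator_of_isPrincipal {A : Type*} [CommRing A] {E I 𝔪 : Ideal A} (hEI : E ≤ I)
    (h : (saturation (I.map (Ideal.Quotient.mk E)) (𝔪.map (Ideal.Quotient.mk E))).IsPrincipal) :
    ∃ f : A, saturation I 𝔪 = Ideal.span {f} ⊔ E := by
  obtain ⟨g, hg⟩ := h
  obtain ⟨f, rfl⟩ := Ideal.Quotient.mk_surjective g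
  refine ⟨f, ?_⟩
  ext x
  rw [← mk_mem_saturation_iff hEI, hg]
  change _ ∈ Ideal.span _ ↔ _
  rw [← Set.image_singleton, ← Ideal.map_span, ← Ideal.mem_comap,
    Ideal.comap_map_of_surjective _ Ideal.Quotient.mk_surjective, ← RingHom.ker_eq_comap_bot,
    Ideal.mk_ker]

/-- A homogeneous ideal that is generated by one element modulo a homogeneous ideal `E` is
generated by one homogeneous element modulo `E`. -/
theorem exists_homogeneous_generator {I E : Ideal (PolyRing K n)} {f : PolyRing K n}
    (hE : E.IsHomogeneous (stdGrading K n)) (hI : I.IsHomogeneous (stdGrading K n))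
    (hne : I ≠ E) (h : I = Ideal.span {f} ⊔ E) :
    ∃ (d : ℕ) (g : PolyRing K n), g.IsHomogeneous d ∧ I = Ideal.span {g} ⊔ E := by
  classical
  have hfE : ∃ d, MvPolynomial.homogeneousComponent d f ∉ E := by
    by_contra! hcon
    refine hne ?_
    rw [h, sup_eq_right, Ideal.span_singleton_le_iff_mem,
      MvPolynomial.mem_iff_homogeneousComponent_mem hE]
    exact hcon
  -- The generator is the lowest component of `f` that is not in `E`.
  let d := Nat.find hfE
  have hd : MvPolynomial.homogeneousComponent d f ∉ E := Nat.find_spec hfE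
  have hlt : ∀ j < d, MvPolynomial.homogeneousComponent j f ∈ E := fun j hj =>
    not_not.mp (Nat.find_min hfE hj)
  set g := MvPolynomial.homogeneousComponent d f with hgdef
  have hfI : f ∈ I := h ▸ Ideal.mem_sup_left (Ideal.mem_span_singleton_self f)
  have hgI : g ∈ I := MvPolynomial.homogeneousComponent_mem_of_mem hI hfI d
  have hEI : E ≤ I := h ▸ le_sup_right
  refine ⟨d, g, MvPolynomial.homogeneousComponent_isHomogeneous d f, le_antisymm ?_
    (sup_le ((Ideal.span_singleton_le_iff_mem _).mpr hgI) hEI)⟩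
  set I' := Ideal.span {g} ⊔ E with hI'
  have hEI' : E ≤ I' := le_sup_right
  have hgI' : g ∈ I' := Ideal.mem_sup_left (Ideal.mem_span_singleton_self g)
  obtain ⟨u, v, hv, huv⟩ : ∃ u v, v ∈ E ∧ u * f + v = g := by
    have := h ▸ hgI
    obtain ⟨w, hw, v, hv, hwv⟩ := Submodule.mem_sup.mp this
    obtain ⟨u, rfl⟩ := Ideal.mem_span_singleton'.mp hw
    exact ⟨u, v, hv, hwv⟩
  have hcomp : ∀ i, MvPolynomial.homogeneousComponent i g -
      MvPolynomial.homogeneousComponent 0 u * MvPolynomial.homogeneousComponent i f =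
      ∑ j ∈ Finset.range i, MvPolynomial.homogeneousComponent (i - j) u *
        MvPolynomial.homogeneousComponent j f + MvPolynomial.homogeneousComponent i v := by
    intro i
    rw [← huv, map_add, homogeneousComponent_mul, Finset.sum_range_succ, Nat.sub_self]
    ring
  -- In degree `d`, `g = u f + v` reads `g ≡ u_0 g` modulo `E`, because the lower components of `f`
  -- are in `E`. If `1 - u_0` were a nonzero constant, `g` would lie in `E`.
  have hu0 : MvPolynomial.homogeneousComponent 0 u = 1 := by
    have h1 := hcomp d
    rw [MvPolynomial.homogeneousComponent_eq_self
      (MvPolynomial.homogeneousComponent_isHomogeneous d f), ← hgdef,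
      MvPolynomial.homogeneousComponent_zero] at h1
    have h2 : (MvPolynomial.C (1 - MvPolynomial.coeff 0 u) : PolyRing K n) * g ∈ E := by
      rw [map_sub, map_one, sub_mul, one_mul, h1]
      refine add_mem (sum_mem fun j hj => E.mul_mem_left _ (hlt j (Finset.mem_range.mp hj)))
        (MvPolynomial.homogeneousComponent_mem_of_mem hE hv d)
    rw [MvPolynomial.homogeneousComponent_zero]
    by_contra hne1
    have h3 : (1 - MvPolynomial.coeff 0 u) ≠ 0 := fun h0 => hne1 (by
      rw [← sub_eq_zero.mp h0, map_one])
    exact hd ((E.unit_mul_mem_iff_mem ((IsUnit.mk0 _ h3).map MvPolynomial.C)).mp h2)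
  -- As `u_0 = 1`, the degree `i` part of `g = u f + v` expresses `f_i` through lower components of
  -- `f`, `g` and `E`.
  have hall : ∀ i, MvPolynomial.homogeneousComponent i f ∈ I' := by
    intro i
    induction i using Nat.strong_induction_on with
    | _ i ih =>
      have h1 := hcomp i
      rw [hu0, one_mul, sub_eq_iff_eq_add] at h1
      have h2 : MvPolynomial.homogeneousComponent i g ∈ I' := by
        rw [MvPolynomial.homogeneousComponent_of_mem
          (MvPolynomial.homogeneousComponent_isHomogeneous d f)]
        split_ifs
        · exact hgI'
        · exact I'.zero_mem
      rw [h1] at h2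
      refine (I'.add_mem_iff_right (add_mem (sum_mem fun j hj => ?_) ?_)).mp h2
      · exact I'.mul_mem_left _ (ih j (Finset.mem_range.mp hj))
      · exact hEI' (MvPolynomial.homogeneousComponent_mem_of_mem hE hv i)
  rw [h]
  refine sup_le ((Ideal.span_singleton_le_iff_mem _).mpr ?_) hEI'
  rw [← MvPolynomial.sum_homogeneousComponent f]
  exact sum_mem fun i _ => hall i

end Saturation

/-! ### The determinant trick and integral extensions -/

section CommutativeAlgebra

variable {A : Type*} [CommRing A]

/-- A form of the Cayley–Hamilton theorem relative to a submodule `N`. -/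
theorem exists_pow_add_smul_mem {M : Type*} [AddCommGroup M] [Module A M] [Module.Finite A M]
    (N : Submodule A M) (I : Ideal A) (s : A)
    (h : ∀ m : M, s • m ∈ N ⊔ I • (⊤ : Submodule A M)) :
    ∃ r : ℕ, ∃ q ∈ I, ∀ m : M, (s ^ r + q) • m ∈ N := by
  -- Multiplication by `s` maps `M/N` into `I (M/N)`, so Cayley–Hamilton gives a monic equation
  -- whose lower coefficients lie in `I`.
  obtain ⟨p, hp, -, hcoeff, haeval⟩ :=
    LinearMap.exists_monic_and_natDegree_eq_and_coeff_mem_pow_and_aeval_eq_zero A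
      (s • LinearMap.id : Module.End A (M ⧸ N)) I (by
        rintro _ ⟨m, rfl⟩
        obtain ⟨m, rfl⟩ := N.mkQ_surjective m
        obtain ⟨u, hu, v, hv, huv⟩ := Submodule.mem_sup.mp (h m)
        have h1 : (s • LinearMap.id : Module.End A (M ⧸ N)) (N.mkQ m) = N.mkQ v := by
          rw [LinearMap.smul_apply, LinearMap.id_apply, ← map_smul, ← huv, map_add,
            show N.mkQ u = 0 from (Submodule.Quotient.mk_eq_zero N).mpr hu, zero_add]
        rw [h1]
        have h2 := Submodule.mem_map_of_mem (f := N.mkQ) hv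
        rw [Submodule.map_smul''] at h2
        exact Submodule.smul_mono le_rfl le_top h2)
  have hpow : ∀ k : ℕ, (s • LinearMap.id : Module.End A (M ⧸ N)) ^ k = s ^ k • LinearMap.id := by
    intro k
    change (s • (1 : Module.End A (M ⧸ N))) ^ k = _
    rw [_root_.smul_pow, one_pow]
    rfl
  refine ⟨p.natDegree, ∑ i ∈ Finset.range p.natDegree, p.coeff i * s ^ i, ?_, fun m => ?_⟩
  · refine sum_mem fun i hi => I.mul_mem_right _ ?_
    have := Finset.mem_range.mp hi
    exact Ideal.pow_le_self (by omega) (hcoeff i)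
  · rw [← Submodule.Quotient.mk_eq_zero N]
    have h1 := LinearMap.congr_fun haeval (N.mkQ m)
    rw [Polynomial.aeval_eq_sum_range, Finset.sum_range_succ, hp.coeff_natDegree, one_smul] at h1
    simp only [hpow, LinearMap.add_apply, LinearMap.sum_apply, LinearMap.smul_apply,
      LinearMap.id_apply, LinearMap.zero_apply] at h1
    rw [Submodule.Quotient.mk_smul, add_smul, Finset.sum_smul, add_comm]
    simp only [mul_smul]
    exact h1

theorem finite_quotient_of_monic_mem {I : Ideal (Polynomial A)} {f : Polynomial A} (hf : f.Monic)
    (hfI : f ∈ I) : Module.Finite A (Polynomial A ⧸ I) := by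
  have h1 : Module.Finite A (Polynomial A ⧸ Ideal.span {f}) := hf.finite_quotient
  exact Module.Finite.of_surjective
    (Ideal.Quotient.factorₐ A ((Ideal.span_singleton_le_iff_mem I).mpr hfI)).toLinearMap
    (Ideal.Quotient.factor_surjective ((Ideal.span_singleton_le_iff_mem I).mpr hfI))

theorem finite_quotient_of_aeval_mem {B : Type*} [CommRing B] [Algebra A B] {y : B}
    (hsurj : Function.Surjective (Polynomial.aeval y : Polynomial A →ₐ[A] B)) {I : Ideal B}
    {f : Polynomial A} (hf : f.Monic) (hfI : Polynomial.aeval y f ∈ I) :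
    Module.Finite A (B ⧸ I) := by
  have := finite_quotient_of_monic_mem (I := I.comap (Polynomial.aeval y : _ →ₐ[A] B)) hf hfI
  refine Module.Finite.of_surjective (Ideal.Quotient.liftₐ
    (I.comap (Polynomial.aeval y : Polynomial A →ₐ[A] B))
    ((Ideal.Quotient.mkₐ A I).comp (Polynomial.aeval y))
    fun P hP => Ideal.Quotient.eq_zero_iff_mem.mpr hP).toLinearMap fun x => ?_
  obtain ⟨r, rfl⟩ := Ideal.Quotient.mk_surjective x
  obtain ⟨P, rfl⟩ := hsurj r
  exact ⟨Ideal.Quotient.mk _ P, rfl⟩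

/-- If `A[X]/I` is finite over `A` and `t F ∈ I + 𝔮 A[X]` for a monic polynomial `F` of degree `e`,
then `I` contains a polynomial of degree at most `e` whose coefficient at `X ^ e` is congruent to
a power of `t` modulo `𝔮`. -/
theorem exists_mem_of_C_mul_mem_sup {I : Ideal (Polynomial A)} {f : Polynomial A} (hf : f.Monic)
    (hfI : f ∈ I) {𝔮 : Ideal A} {F : Polynomial A} (hF : F.Monic) {t : A}
    (ht : Polynomial.C t * F ∈ I ⊔ 𝔮.map Polynomial.C) :
    ∃ r : ℕ, ∃ q ∈ 𝔮, ∃ P ∈ I, P.natDegree ≤ F.natDegree ∧ P.coeff F.natDegree = t ^ r + q := by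
  have := finite_quotient_of_monic_mem hf hfI
  set e := F.natDegree with he
  let π : Polynomial A →ₗ[A] Polynomial A ⧸ I := (Ideal.Quotient.mkₐ A I).toLinearMap
  have hπ : ∀ g ∈ I ⊔ 𝔮.map Polynomial.C, π g ∈ 𝔮 • (⊤ : Submodule A (Polynomial A ⧸ I)) := by
    intro g hg
    obtain ⟨u, hu, v, hv, rfl⟩ := Submodule.mem_sup.mp hg
    have hu0 : π u = 0 := Ideal.Quotient.eq_zero_iff_mem.mpr hu
    rw [map_add, hu0, zero_add]
    have hv' : v ∈ 𝔮 • (⊤ : Submodule A (Polynomial A)) := by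
      rw [Ideal.smul_top_eq_map]
      exact hv
    have h2 := Submodule.mem_map_of_mem (f := π) hv'
    rw [Submodule.map_smul''] at h2
    exact Submodule.smul_mono le_rfl le_top h2
  -- Here `N` is the image of the polynomials of degree `< e`. Division by `F` writes `g` as a
  -- remainder in `N` plus a multiple of `F`, and `t` sends the latter into `𝔮 (A[X]/I)`.
  obtain ⟨r, q, hq, h⟩ := exists_pow_add_smul_mem ((Polynomial.degreeLT A e).map π) 𝔮 t (by
    intro m
    obtain ⟨g, rfl⟩ := Ideal.Quotient.mk_surjective m
    change t • π g ∈ _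
    rw [← Polynomial.modByMonic_add_div g F, map_add, smul_add]
    refine add_mem (Submodule.mem_sup_left ?_) (Submodule.mem_sup_right ?_)
    · refine Submodule.smul_mem _ _ (Submodule.mem_map_of_mem ?_)
      rw [Polynomial.mem_degreeLT]
      by_cases hA : Nontrivial A
      · rw [he, ← Polynomial.degree_eq_natDegree hF.ne_zero]
        exact Polynomial.degree_modByMonic_lt g hF
      · rw [not_nontrivial_iff_subsingleton] at hA
        rw [Subsingleton.elim (g %ₘ F) 0, Polynomial.degree_zero]
        exact WithBot.bot_lt_coe _
    · rw [← map_smul, ← Polynomial.C_mul', ← mul_assoc]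
      exact hπ _ (Ideal.mul_mem_right _ _ ht))
  -- Applied to `X ^ e`, the relation gives `(t ^ r + q) X ^ e - p ∈ I` with `deg p < e`.
  obtain ⟨p, hp, hpe⟩ := h (π (Polynomial.X ^ e))
  rw [← map_smul, ← Polynomial.C_mul', Polynomial.C_mul_X_pow_eq_monomial] at hpe
  refine ⟨r, q, hq, Polynomial.monomial e (t ^ r + q) - p, ?_, ?_, ?_⟩
  · exact Ideal.Quotient.eq.mp hpe.symm
  · refine (Polynomial.natDegree_sub_le _ _).trans (max_le (Polynomial.natDegree_monomial_le _) ?_)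
    exact Polynomial.natDegree_le_of_degree_le (Polynomial.mem_degreeLT.mp hp).le
  · rw [Polynomial.coeff_sub, Polynomial.coeff_monomial, if_pos rfl,
      Polynomial.coeff_eq_zero_of_degree_lt (Polynomial.mem_degreeLT.mp hp), sub_zero]

/-- Incomparability bounds the dimension of `B` above. Below, lying over and going up lift a chain
of two primes; knowing the kernel up to radical suffices, since primes containing `J` contain
`J.radical`. -/
theorem ringKrullDim_eq_one_of_isIntegral {B : Type*} [CommRing B] [Algebra A B]
    [Algebra.IsIntegral A B] {J : Ideal A} (h1 : J ≤ RingHom.ker (algebraMap A B))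
    (h2 : RingHom.ker (algebraMap A B) ≤ J.radical) (hJ : ringKrullDim (A ⧸ J) = 1) :
    ringKrullDim B = 1 := by
  rw [ringKrullDim_quotient] at hJ
  apply le_antisymm
  · rw [← hJ]
    refine Order.krullDim_le_of_strictMono
      (fun P => ⟨PrimeSpectrum.comap (algebraMap A B) P, fun a ha => ?_⟩) fun P Q hPQ => ?_
    · change algebraMap A B a ∈ P.asIdeal
      rw [RingHom.mem_ker.mp (h1 ha)]
      exact zero_mem _
    · change Ideal.comap (algebraMap A B) P.asIdeal < Ideal.comap (algebraMap A B) Q.asIdeal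
      exact Ideal.IsIntegral.comap_lt_comap hPQ
  · obtain ⟨⟨P, hP⟩, ⟨Q, hQ⟩, hPQ⟩ := Order.one_le_krullDim_iff.mp hJ.ge
    have hker : (⊥ : Ideal B).comap (algebraMap A B) ≤ P.asIdeal :=
      h2.trans (P.isPrime.radical_le_iff.mpr hP)
    obtain ⟨P', -, hP', hP'P⟩ := Ideal.exists_ideal_over_prime_of_isIntegral P.asIdeal ⊥ hker
    obtain ⟨Q', hQ'P', hQ', hQ'Q⟩ := Ideal.exists_ideal_over_prime_of_isIntegral_of_isPrime
      Q.asIdeal P' (hP'P.trans_le hPQ.le)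
    refine Order.one_le_krullDim_iff.mpr ⟨⟨P', hP'⟩, ⟨Q', hQ'⟩, lt_of_le_of_ne hQ'P' fun h => ?_⟩
    have h' : P' = Q' := congrArg PrimeSpectrum.asIdeal h
    refine hPQ.ne (Subtype.ext (PrimeSpectrum.ext ?_))
    change P.asIdeal = Q.asIdeal
    rw [← hP'P, h', hQ'Q]

end CommutativeAlgebra

/-! ### Hilbert functions in dimension one -/

section HilbertFunction

variable {K : Type*} [Field K] {n : ℕ} {𝔭 : Ideal (PolyRing K n)} {a : Fin (n + 1) → K}
  {y : PolyRing K n}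

theorem hilbertPolynomial_eq_C {M : Type*} [AddCommGroup M] [Module K M]
    {ℳ : ℕ → Submodule K M} {c : ℕ} (h : ∀ᶠ d in Filter.atTop, hilbertFunction ℳ d = c) :
    hilbertPolynomial ℳ = Polynomial.C (c : ℚ) := by
  have hc : IsHilbertPolynomial ℳ (Polynomial.C (c : ℚ)) := by
    filter_upwards [h] with d hd
    rw [hd, Polynomial.eval_C]
  have hex : ∃ P : Polynomial ℚ, IsHilbertPolynomial ℳ P := ⟨_, hc⟩
  rw [hilbertPolynomial, dif_pos hex]
  exact hex.choose_spec.unique hc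

/-- In dimension one, the multiplicity of `A/I` is the eventual value of its Hilbert function. -/
theorem quotientMultiplicity_eq {A : Type*} [CommRing A] [Algebra K A] {𝒜 : ℕ → Submodule K A}
    {I : Ideal A} (hdim : ringKrullDim (A ⧸ I) = 1) {c : ℕ}
    (h : ∀ᶠ d in Filter.atTop, hilbertFunction
      (fun d => (𝒜 d).map (Ideal.Quotient.mkₐ K I).toLinearMap) d = c) :
    quotientMultiplicity 𝒜 I = c := by
  rw [quotientMultiplicity, hilbertMultiplicity, hilbertPolynomial_eq_C h,
    Module.supportDim_quotient_eq_ringKrullDim, hdim, if_neg one_ne_zero,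
    Polynomial.leadingCoeff_C]
  -- In dimension one the factorial is `0! = 1`.
  simp

theorem finrank_map_mk_le {A : Type*} [CommRing A] [Algebra K A] {I : Ideal A}
    {V W : Submodule K A} [Module.Finite K V] (l : A)
    (h : ∀ s ∈ W, ∃ j ∈ I, ∃ t ∈ V, s = j + t * l) :
    Module.finrank K (W.map (Ideal.Quotient.mkₐ K I).toLinearMap) ≤
      Module.finrank K (V.map (Ideal.Quotient.mkₐ K I).toLinearMap) := by
  have hle : W.map (Ideal.Quotient.mkₐ K I).toLinearMap ≤
      (V.map (Ideal.Quotient.mkₐ K I).toLinearMap).map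
        (LinearMap.mulRight K (Ideal.Quotient.mk I l)) := by
    rintro _ ⟨s, hs, rfl⟩
    obtain ⟨j, hj, t, ht, rfl⟩ := h s hs
    refine ⟨_, ⟨t, ht, rfl⟩, ?_⟩
    change Ideal.Quotient.mk I t * Ideal.Quotient.mk I l = Ideal.Quotient.mk I (j + t * l)
    rw [map_add, Ideal.Quotient.eq_zero_iff_mem.mpr hj, zero_add, map_mul]
  exact (Submodule.finrank_mono hle).trans (Submodule.finrank_map_le _ _)

instance finite_subGrading (𝔭 : Ideal (PolyRing K n)) (d : ℕ) :
    Module.Finite K (subGrading 𝔭 d) := by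
  have : Module.Finite K (stdGrading K n d) :=
    Module.Finite.iff_fg.mpr (MvPolynomial.homogeneousSubmodule_fg _ _ d)
  refine Module.Finite.of_injective
    (((coordSubalgebra 𝔭).val.toLinearMap.comp (subGrading 𝔭 d).subtype).codRestrict
      (stdGrading K n d) fun f => f.2) fun f g hfg => ?_
  exact Subtype.ext (Subtype.ext (congrArg (fun u : stdGrading K n d => (u : PolyRing K n)) hfg))

instance isNoetherianRing_coordSubalgebra (𝔭 : Ideal (PolyRing K n)) :
    IsNoetherianRing (coordSubalgebra 𝔭) := by
  have : Module.Finite K (stdGrading K n 1) :=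
    Module.Finite.iff_fg.mpr (MvPolynomial.homogeneousSubmodule_fg _ _ 1)
  have hfg : (linearForms 𝔭).FG := by
    rw [← Module.Finite.iff_fg]
    exact Submodule.finiteDimensional_of_le (inf_le_right : linearForms 𝔭 ≤ stdGrading K n 1)
  obtain ⟨s, hs⟩ := hfg
  have : Algebra.FiniteType K (coordSubalgebra 𝔭) := by
    rw [← Subalgebra.fg_iff_finiteType]
    refine ⟨s, ?_⟩
    rw [coordSubalgebra, ← hs, Algebra.adjoin_span]
  exact Algebra.FiniteType.isNoetherianRing K _

/-- The irrelevant ideal of `S`. -/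
noncomputable def subIrrelevant (𝔭 : Ideal (PolyRing K n)) : Ideal (coordSubalgebra 𝔭) :=
  RingHom.ker ((MvPolynomial.constantCoeff : PolyRing K n →+* K).comp
    (algebraMap (coordSubalgebra 𝔭) (PolyRing K n)))

theorem mem_subIrrelevant {f : coordSubalgebra 𝔭} :
    f ∈ subIrrelevant 𝔭 ↔ MvPolynomial.constantCoeff (f : PolyRing K n) = 0 := Iff.rfl

instance subIrrelevant_isMaximal (𝔭 : Ideal (PolyRing K n)) : (subIrrelevant 𝔭).IsMaximal := by
  refine RingHom.ker_isMaximal_of_surjective _ fun c => ⟨algebraMap K _ c, ?_⟩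
  exact MvPolynomial.constantCoeff_C (Fin (n + 1)) c

theorem subGrading_one_le_subIrrelevant {f : coordSubalgebra 𝔭} (hf : f ∈ subGrading 𝔭 1) :
    f ∈ subIrrelevant 𝔭 := by
  rw [mem_subIrrelevant, MvPolynomial.constantCoeff_eq]
  exact MvPolynomial.IsHomogeneous.coeff_eq_zero (mem_subGrading.mp hf) (by simp)

theorem mem_subIrrelevant_pow (ha : IsConePoint 𝔭 a) (hy : y.IsHomogeneous 1)
    (hya : MvPolynomial.eval a y = 1) {d : ℕ} {f : coordSubalgebra 𝔭} (hf : f ∈ subGrading 𝔭 d) :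
    f ∈ Ideal.span (subGrading 𝔭 1 : Set (coordSubalgebra 𝔭)) ^ d := by
  have h1 := subGrading_one_pow ha hy hya d hf
  clear hf
  have hle : subGrading 𝔭 1 ≤
      (Ideal.span (subGrading 𝔭 1 : Set (coordSubalgebra 𝔭))).restrictScalars K :=
    fun x hx => Ideal.subset_span hx
  induction d generalizing f with
  | zero => rw [pow_zero, Ideal.one_eq_top]; trivial
  | succ d ih =>
    rw [pow_succ] at h1 ⊢
    induction h1 using Submodule.mul_induction_on' with
    | mem_mul_mem u hu v hv => exact Ideal.mul_mem_mul (ih hu) (hle hv)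
    | add u _ v _ hu hv => exact add_mem hu hv

theorem subIrrelevant_le_span (ha : IsConePoint 𝔭 a) (hy : y.IsHomogeneous 1)
    (hya : MvPolynomial.eval a y = 1) :
    subIrrelevant 𝔭 ≤ Ideal.span (subGrading 𝔭 1 : Set (coordSubalgebra 𝔭)) := by
  classical
  intro f hf
  rw [← DirectSum.sum_support_decompose (subGrading 𝔭) f]
  refine sum_mem fun d _ => ?_
  rcases Nat.eq_zero_or_pos d with rfl | hd
  · have h0 : (DirectSum.decompose (subGrading 𝔭) f 0 : coordSubalgebra 𝔭) = 0 := by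
      apply Subtype.ext
      rw [coe_decompose_subGrading, MvPolynomial.homogeneousComponent_zero,
        ← MvPolynomial.constantCoeff_eq, mem_subIrrelevant.mp hf, map_zero]
      rfl
    rw [h0]
    exact zero_mem _
  · exact Ideal.pow_le_self hd.ne'
      (mem_subIrrelevant_pow ha hy hya (DirectSum.decompose (subGrading 𝔭) f d).2)

theorem le_subIrrelevant {I : Ideal (coordSubalgebra 𝔭)}
    (hI : I.IsHomogeneous (subGrading 𝔭)) (htop : I ≠ ⊤) : I ≤ subIrrelevant 𝔭 :=
  fun _ hs => constantCoeff_eq_zero_of_mem hI htop hs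

theorem isHomogeneous_of_mem_minimalPrimes {I P : Ideal (coordSubalgebra 𝔭)}
    (hI : I.IsHomogeneous (subGrading 𝔭)) (hP : P ∈ I.minimalPrimes) :
    P.IsHomogeneous (subGrading 𝔭) := by
  have hle := Ideal.toIdeal_homogeneousCore_le (subGrading 𝔭) P
  have h1 : P ≤ (P.homogeneousCore (subGrading 𝔭)).toIdeal := by
    refine hP.2 ⟨hP.1.1.homogeneousCore, ?_⟩ hle
    exact hI.toIdeal_homogeneousCore_eq_self.ge.trans (Ideal.homogeneousCore_mono _ hP.1.2)
  rw [le_antisymm h1 hle]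
  exact HomogeneousIdeal.isHomogeneous _

/-- Otherwise the irrelevant ideal of `S` would be the only prime containing `I`, and the quotient
would have no chain of two primes. -/
theorem exists_mem_subGrading_one_notMem (ha : IsConePoint 𝔭 a) (hy : y.IsHomogeneous 1)
    (hya : MvPolynomial.eval a y = 1) {I : Ideal (coordSubalgebra 𝔭)}
    (hdim : ringKrullDim (coordSubalgebra 𝔭 ⧸ I) = 1) :
    ∃ l ∈ subGrading 𝔭 1, l ∉ I.radical := by
  by_contra! hcon
  have h1 : subIrrelevant 𝔭 ≤ I.radical :=
    (subIrrelevant_le_span ha hy hya).trans (Ideal.span_le.mpr hcon)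
  rw [ringKrullDim_quotient] at hdim
  obtain ⟨⟨P, hP⟩, ⟨Q, hQ⟩, hPQ⟩ := Order.one_le_krullDim_iff.mp hdim.ge
  have h2 := (subIrrelevant_isMaximal 𝔭).eq_of_le P.isPrime.ne_top
    (h1.trans (P.isPrime.radical_le_iff.mpr hP))
  have h3 := (subIrrelevant_isMaximal 𝔭).eq_of_le Q.isPrime.ne_top
    (h1.trans (Q.isPrime.radical_le_iff.mpr hQ))
  exact hPQ.ne (Subtype.ext (PrimeSpectrum.ext (h2.symm.trans h3)))

/-- A vector space over an infinite field is not a finite union of proper subspaces, so some `l ∈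
S_1` avoids every minimal prime of `I` other than the irrelevant ideal. In dimension one, a prime
minimal over `I + (l)` is then the irrelevant ideal. -/
theorem exists_parameter [Infinite K] {I : Ideal (coordSubalgebra 𝔭)}
    (ha : IsConePoint 𝔭 a) (hy : y.IsHomogeneous 1) (hya : MvPolynomial.eval a y = 1)
    (hI : I.IsHomogeneous (subGrading 𝔭)) (hdim : ringKrullDim (coordSubalgebra 𝔭 ⧸ I) = 1) :
    ∃ l ∈ subGrading 𝔭 1, subIrrelevant 𝔭 ≤ (I ⊔ Ideal.span {l}).radical := by
  classical
  have hfin := I.finite_minimalPrimes_of_isNoetherianRing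
  let T : Finset (Ideal (coordSubalgebra 𝔭)) := hfin.toFinset.erase (subIrrelevant 𝔭)
  obtain ⟨l, hl⟩ : ∃ l : subGrading 𝔭 1, ∀ P ∈ T, (l : coordSubalgebra 𝔭) ∉ P := by
    have htop : (⊤ : Submodule K (subGrading 𝔭 1)) ∉
        T.image fun P => (P.restrictScalars K).comap (subGrading 𝔭 1).subtype := by
      intro hmem
      obtain ⟨P, hP, hPtop⟩ := Finset.mem_image.mp hmem
      have hP' := Finset.mem_erase.mp hP
      have hPmin : P ∈ I.minimalPrimes := hfin.mem_toFinset.mp hP'.2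
      refine hP'.1 ((subIrrelevant_isMaximal 𝔭).eq_of_le hPmin.1.1.ne_top
        ((subIrrelevant_le_span ha hy hya).trans (Ideal.span_le.mpr fun x hx => ?_))).symm
      exact (hPtop.ge (Submodule.mem_top : (⟨x, hx⟩ : subGrading 𝔭 1) ∈ ⊤) : _)
    obtain ⟨l, hl⟩ := (Set.ne_univ_iff_exists_notMem _).mp
      (Subspace.biUnion_ne_univ_of_top_notMem (k := K) (E := subGrading 𝔭 1)
        (s := T.image fun P => (P.restrictScalars K).comap (subGrading 𝔭 1).subtype) htop)
    refine ⟨l, fun P hP hlP => hl ?_⟩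
    exact Set.mem_biUnion (Finset.mem_image_of_mem _ hP) hlP
  refine ⟨l, l.2, ?_⟩
  have hhom : (I ⊔ Ideal.span {(l : coordSubalgebra 𝔭)}).IsHomogeneous (subGrading 𝔭) := by
    refine hI.sup (Ideal.homogeneous_span _ _ fun x hx => ?_)
    rw [Set.mem_singleton_iff.mp hx]
    exact ⟨1, l.2⟩
  rw [← Ideal.sInf_minimalPrimes]
  refine le_sInf fun P hP => ?_
  have hPhom := isHomogeneous_of_mem_minimalPrimes hhom hP
  have hPprime := hP.1.1
  have hIP : I ≤ P := le_sup_left.trans hP.1.2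
  have hlP : (l : coordSubalgebra 𝔭) ∈ P :=
    hP.1.2 (Ideal.mem_sup_right (Ideal.mem_span_singleton_self _))
  have hPle := le_subIrrelevant hPhom hPprime.ne_top
  obtain ⟨Q, hQ, hQP⟩ := Ideal.exists_minimalPrimes_le hIP
  by_cases hQm : Q = subIrrelevant 𝔭
  · exact hQm ▸ hQP
  · by_contra hnot
    have hlQ := hl Q (Finset.mem_erase.mpr ⟨hQm, hfin.mem_toFinset.mpr hQ⟩)
    rw [ringKrullDim_quotient] at hdim
    let p : PrimeSpectrum.zeroLocus (I : Set (coordSubalgebra 𝔭)) := ⟨⟨P, hPprime⟩, hIP⟩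
    let q : PrimeSpectrum.zeroLocus (I : Set (coordSubalgebra 𝔭)) := ⟨⟨Q, hQ.1.1⟩, hQ.1.2⟩
    let m : PrimeSpectrum.zeroLocus (I : Set (coordSubalgebra 𝔭)) :=
      ⟨⟨subIrrelevant 𝔭, (subIrrelevant_isMaximal 𝔭).isPrime⟩, hIP.trans hPle⟩
    rcases Order.krullDim_le_one_iff.mp hdim.le p with hmin | hmax
    -- If `P` were minimal over `I` it would equal `Q`, which does not contain `l`.
    · exact hlQ (hmin (b := q) hQP hlP)
    · exact hnot (hmax (b := m) hPle)

/-- Modulo `I`, a power of the irrelevant ideal lies in `(l)`, so multiplication by `l` is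
surjective in large degrees. The Hilbert function is eventually non-increasing, hence eventually
constant. -/
theorem exists_hilbertFunction_eq [Infinite K] {I : Ideal (coordSubalgebra 𝔭)}
    (ha : IsConePoint 𝔭 a) (hy : y.IsHomogeneous 1) (hya : MvPolynomial.eval a y = 1)
    (hI : I.IsHomogeneous (subGrading 𝔭)) (hdim : ringKrullDim (coordSubalgebra 𝔭 ⧸ I) = 1) :
    ∃ c, ∀ᶠ d in Filter.atTop, hilbertFunction
      (fun d => (subGrading 𝔭 d).map (Ideal.Quotient.mkₐ K I).toLinearMap) d = c := by
  obtain ⟨l, hl, hrad⟩ := exists_parameter ha hy hya hI hdim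
  obtain ⟨N, hN⟩ := Ideal.exists_pow_le_of_le_radical_of_fg hrad
    (IsNoetherian.noetherian (subIrrelevant 𝔭))
  have hspan : Ideal.span (subGrading 𝔭 1 : Set (coordSubalgebra 𝔭)) ≤ subIrrelevant 𝔭 :=
    Ideal.span_le.mpr fun x hx => subGrading_one_le_subIrrelevant hx
  set H := hilbertFunction
    (fun d => (subGrading 𝔭 d).map (Ideal.Quotient.mkₐ K I).toLinearMap) with hH
  have hanti : ∀ d, N ≤ d → H (d + 1) ≤ H d := by
    intro d hd
    refine finrank_map_mk_le l fun s hs => ?_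
    have h1 : s ∈ I ⊔ Ideal.span {l} :=
      hN (Ideal.pow_le_pow_right (by omega : N ≤ d + 1)
        (Ideal.pow_right_mono hspan _ (mem_subIrrelevant_pow ha hy hya hs)))
    obtain ⟨j, hj, w, hw, hjw⟩ := Submodule.mem_sup.mp h1
    obtain ⟨t, rfl⟩ := Ideal.mem_span_singleton'.mp hw
    have h2 : s = (DirectSum.decompose (subGrading 𝔭) j (d + 1) : coordSubalgebra 𝔭) +
        (DirectSum.decompose (subGrading 𝔭) t d : coordSubalgebra 𝔭) * l := by
      have h3 := congrArg (fun u => (DirectSum.decompose (subGrading 𝔭) u (d + 1) :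
        coordSubalgebra 𝔭)) hjw
      simp only [DirectSum.decompose_add, DirectSum.add_apply, Submodule.coe_add] at h3
      rw [DirectSum.coe_decompose_mul_of_right_mem_of_le _ hl (Nat.le_add_left 1 d),
        DirectSum.decompose_of_mem_same _ hs, Nat.add_sub_cancel] at h3
      exact h3.symm
    exact ⟨_, hI (d + 1) hj, _, (DirectSum.decompose (subGrading 𝔭) t d).2, h2⟩
  have hmono : Antitone fun k => H (N + k) :=
    antitone_nat_of_succ_le fun k => hanti (N + k) (Nat.le_add_right N k)
  obtain ⟨_, ⟨k₀, rfl⟩, hmin⟩ := wellFounded_lt.has_min (Set.range fun k => H (N + k))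
    (Set.range_nonempty _)
  refine ⟨H (N + k₀), Filter.eventually_atTop.mpr ⟨N + k₀, fun d hd => ?_⟩⟩
  obtain ⟨k, rfl⟩ := Nat.exists_eq_add_of_le ((Nat.le_add_right N k₀).trans hd)
  exact le_antisymm (hmono (Nat.le_of_add_le_add_left hd)) (not_lt.mp (hmin _ ⟨k, rfl⟩))

end HilbertFunction

/-! ### Division by a monic polynomial modulo an ideal of coefficients -/

section Remainder

variable {K A : Type*} [Field K] [CommRing A] [Algebra K A]

/-- Over `A/J` the polynomial `F` stays monic of the same degree, and it divides no nonzero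
polynomial of smaller degree. -/
theorem coeff_mem_of_mem_span_sup {J : Ideal A} {F P : Polynomial A} (hF : F.Monic)
    (hdeg : P.natDegree < F.natDegree) (hP : P ∈ Ideal.span {F} ⊔ J.map Polynomial.C) (i : ℕ) :
    P.coeff i ∈ J := by
  by_cases hJ : J = ⊤
  · rw [hJ]; trivial
  have : Nontrivial (A ⧸ J) := Ideal.Quotient.nontrivial_iff.mpr hJ
  obtain ⟨u, hu, v, hv, rfl⟩ := Submodule.mem_sup.mp hP
  obtain ⟨w, rfl⟩ := Ideal.mem_span_singleton'.mp hu
  set ρ := Ideal.Quotient.mk J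
  have hv0 : v.map ρ = 0 := by
    ext j
    rw [Polynomial.coeff_map, Polynomial.coeff_zero]
    exact Ideal.Quotient.eq_zero_iff_mem.mpr (Ideal.mem_map_C_iff.mp hv j)
  have hmap : (w * F + v).map ρ = F.map ρ * w.map ρ := by
    rw [Polynomial.map_add, hv0, add_zero, Polynomial.map_mul, mul_comm]
  have h0 : (w * F + v).map ρ = 0 := by
    by_contra hne
    refine (hF.map ρ).not_dvd_of_natDegree_lt hne ?_ ⟨w.map ρ, hmap⟩
    rw [hF.natDegree_map]
    exact Polynomial.natDegree_map_le.trans_lt hdeg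
  rw [← Ideal.Quotient.eq_zero_iff_mem, ← Polynomial.coeff_map, h0, Polynomial.coeff_zero]

/-- The residues modulo `J` of the coefficients of the remainder of the division by `F`. -/
noncomputable def remainderCoeffs (K : Type*) [Field K] [Algebra K A] (J : Ideal A)
    (F : Polynomial A) : Polynomial A →ₗ[K] (Fin F.natDegree → A ⧸ J) where
  toFun P i := Ideal.Quotient.mk J ((P %ₘ F).coeff i)
  map_add' P Q := by
    ext i
    simp [Polynomial.add_modByMonic]
  map_smul' c P := by
    ext i
    rw [← algebraMap_smul A c P, Polynomial.smul_modByMonic, Polynomial.coeff_smul, smul_eq_mul,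
      map_mul, RingHom.id_apply, Pi.smul_apply, Algebra.smul_def]
    rfl

theorem remainderCoeffs_eq_zero_iff {J : Ideal A} {F : Polynomial A} (hF : F.Monic)
    (P : Polynomial A) :
    remainderCoeffs K J F P = 0 ↔ P ∈ Ideal.span {F} ⊔ J.map Polynomial.C := by
  have hP := Polynomial.modByMonic_add_div P F
  have hdvd : F * (P /ₘ F) ∈ Ideal.span {F} ⊔ J.map Polynomial.C :=
    Ideal.mem_sup_left (Ideal.mem_span_singleton'.mpr ⟨_, mul_comm _ _⟩)
  have hdeg : F ≠ 1 → (P %ₘ F).natDegree < F.natDegree := Polynomial.natDegree_modByMonic_lt P hF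
  constructor
  · intro h
    rw [← hP]
    refine add_mem (Ideal.mem_sup_right (Ideal.mem_map_C_iff.mpr fun i => ?_)) hdvd
    by_cases hi : i < F.natDegree
    · exact Ideal.Quotient.eq_zero_iff_mem.mp (congrFun h ⟨i, hi⟩)
    · have h0 : (P %ₘ F).coeff i = 0 := by
        by_cases hF1 : F = 1
        · rw [hF1, Polynomial.modByMonic_one, Polynomial.coeff_zero]
        · exact Polynomial.coeff_eq_zero_of_natDegree_lt ((hdeg hF1).trans_le (not_lt.mp hi))
      rw [h0]
      exact J.zero_mem
  · intro h
    have h1 : P %ₘ F ∈ Ideal.span {F} ⊔ J.map Polynomial.C := by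
      rw [← hP] at h
      exact ((Ideal.add_mem_iff_left _ hdvd).mp h)
    funext i
    refine Ideal.Quotient.eq_zero_iff_mem.mpr (coeff_mem_of_mem_span_sup hF (hdeg ?_) h1 i)
    rintro rfl
    have := i.2
    simp at this

theorem remainderCoeffs_monomial {J : Ideal A} {F : Polynomial A} (i : Fin F.natDegree) (s : A)
    (hF : F.Monic) :
    remainderCoeffs K J F (Polynomial.monomial i s) = Pi.single i (Ideal.Quotient.mk J s) := by
  have hA : Nontrivial A := by
    by_contra hA
    rw [not_nontrivial_iff_subsingleton] at hA
    exact absurd (i.2.trans_eq Polynomial.natDegree_of_subsingleton) (Nat.not_lt_zero _)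
  have hmod : Polynomial.monomial (i : ℕ) s %ₘ F = Polynomial.monomial (i : ℕ) s := by
    rw [Polynomial.modByMonic_eq_self_iff hF, Polynomial.degree_eq_natDegree hF.ne_zero]
    exact (Polynomial.degree_monomial_le _ _).trans_lt (by exact_mod_cast i.2)
  funext j
  change Ideal.Quotient.mk J ((Polynomial.monomial (i : ℕ) s %ₘ F).coeff j) = _
  rw [hmod, Polynomial.coeff_monomial]
  by_cases hij : i = j
  · subst hij
    rw [if_pos rfl, Pi.single_eq_same]
  · rw [if_neg (fun h => hij (Fin.ext h)), map_zero, Pi.single_eq_of_ne (Ne.symm hij)]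

/-- The polynomials that are homogeneous of degree `d`, for the grading `𝒜` of the coefficients and
a variable of degree one. -/
def polyGrading (𝒜 : ℕ → Submodule K A) (d : ℕ) : Submodule K (Polynomial A) where
  carrier := {P | P.natDegree ≤ d ∧ ∀ i ≤ d, P.coeff i ∈ 𝒜 (d - i)}
  zero_mem' := ⟨by simp, fun i _ => by simp⟩
  add_mem' := fun {P Q} hP hQ => ⟨(Polynomial.natDegree_add_le _ _).trans (max_le hP.1 hQ.1),
    fun i hi => by
      rw [Polynomial.coeff_add]
      exact add_mem (hP.2 i hi) (hQ.2 i hi)⟩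
  smul_mem' := fun c P hP => ⟨(Polynomial.natDegree_smul_le _ _).trans hP.1,
    fun i hi => by
      rw [Polynomial.coeff_smul]
      exact Submodule.smul_mem _ _ (hP.2 i hi)⟩

theorem monomial_mem_polyGrading {𝒜 : ℕ → Submodule K A} {d i : ℕ} (hi : i ≤ d) {s : A}
    (hs : s ∈ 𝒜 (d - i)) : Polynomial.monomial i s ∈ polyGrading 𝒜 d := by
  refine ⟨(Polynomial.natDegree_monomial_le _).trans hi, fun j _ => ?_⟩
  rw [Polynomial.coeff_monomial]
  split_ifs with h
  · exact h ▸ hs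
  · exact zero_mem _

/-- A monomial of degree `i ≥ deg F` is reduced modulo `F` to monomials of smaller degree in the
variable; as `F` is homogeneous, the total degree `d` is preserved. -/
theorem remainderCoeffs_monomial_mem {𝒜 : ℕ → Submodule K A} [SetLike.GradedMonoid 𝒜] (J : Ideal A)
    {F : Polynomial A} (hF : F.Monic) (hFmem : F ∈ polyGrading 𝒜 F.natDegree) {d : ℕ} (i : ℕ)
    (hi : i ≤ d) (s : A) (hs : s ∈ 𝒜 (d - i)) :
    remainderCoeffs K J F (Polynomial.monomial i s) ∈ Submodule.pi Set.univ
      fun j : Fin F.natDegree => (𝒜 (d - j)).map (Ideal.Quotient.mkₐ K J).toLinearMap := by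
  classical
  induction i using Nat.strong_induction_on generalizing s with
  | _ i ih =>
    by_cases hie : i < F.natDegree
    · rw [remainderCoeffs_monomial ⟨i, hie⟩ s hF]
      intro j _
      by_cases hj : j = ⟨i, hie⟩
      · subst hj
        rw [Pi.single_eq_same]
        exact ⟨s, hs, rfl⟩
      · rw [Pi.single_eq_of_ne hj]
        exact zero_mem _
    · push Not at hie
      have hsplit : Polynomial.monomial i s = Polynomial.monomial (i - F.natDegree) s * F -
          ∑ j ∈ Finset.range F.natDegree,
            Polynomial.monomial (i - F.natDegree + j) (s * F.coeff j) := by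
        have hFsum : Polynomial.monomial (i - F.natDegree) s * F =
            ∑ j ∈ Finset.range (F.natDegree + 1),
              Polynomial.monomial (i - F.natDegree + j) (s * F.coeff j) := by
          simp only [← Polynomial.monomial_mul_monomial]
          rw [← Finset.mul_sum, ← F.as_sum_range]
        rw [hFsum, Finset.sum_range_succ, hF.coeff_natDegree, mul_one, Nat.sub_add_cancel hie,
          add_sub_cancel_left]
      have h0 : remainderCoeffs K J F (Polynomial.monomial (i - F.natDegree) s * F) = 0 :=
        (remainderCoeffs_eq_zero_iff hF _).mpr
          (Ideal.mem_sup_left (Ideal.mem_span_singleton'.mpr ⟨_, rfl⟩))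
      rw [hsplit, map_sub, h0, zero_sub, map_sum]
      refine neg_mem (sum_mem fun j hj => ?_)
      rw [Finset.mem_range] at hj
      refine ih _ (by omega) (by omega) _ ?_
      have hmul := SetLike.mul_mem_graded hs (hFmem.2 j hj.le)
      rwa [show d - i + (F.natDegree - j) = d - (i - F.natDegree + j) by omega] at hmul

theorem map_remainderCoeffs {𝒜 : ℕ → Submodule K A} [SetLike.GradedMonoid 𝒜] (J : Ideal A)
    {F : Polynomial A} (hF : F.Monic) (hFmem : F ∈ polyGrading 𝒜 F.natDegree) {d : ℕ}
    (hd : F.natDegree ≤ d) :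
    (polyGrading 𝒜 d).map (remainderCoeffs K J F) = Submodule.pi Set.univ
      fun j : Fin F.natDegree => (𝒜 (d - j)).map (Ideal.Quotient.mkₐ K J).toLinearMap := by
  classical
  apply le_antisymm
  · rintro _ ⟨P, hP, rfl⟩
    rw [P.as_sum_range' (d + 1) (Nat.lt_succ_of_le hP.1), map_sum]
    refine sum_mem fun i hi => ?_
    have hi' : i ≤ d := Nat.lt_succ_iff.mp (Finset.mem_range.mp hi)
    exact remainderCoeffs_monomial_mem J hF hFmem i hi' _ (hP.2 i hi')
  · intro v hv
    choose s hs hsv using fun j => hv j (Set.mem_univ j)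
    refine ⟨∑ j : Fin F.natDegree, Polynomial.monomial (j : ℕ) (s j), sum_mem fun j _ =>
      monomial_mem_polyGrading (j.2.le.trans hd) (hs j), ?_⟩
    rw [map_sum, ← Finset.univ_sum_single v]
    refine Finset.sum_congr rfl fun j _ => ?_
    rw [remainderCoeffs_monomial j _ hF]
    exact congrArg _ (hsv j)

theorem finrank_submodule_pi {ι : Type*} [Fintype ι] {V : ι → Type*} [∀ i, AddCommGroup (V i)]
    [∀ i, Module K (V i)] (q : ∀ i, Submodule K (V i)) [∀ i, Module.Finite K (q i)] :
    Module.finrank K (Submodule.pi Set.univ q) = ∑ i, Module.finrank K (q i) := by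
  rw [← Module.finrank_pi_fintype]
  refine LinearEquiv.finrank_eq
    { toFun := fun v i => ⟨v.1 i, v.2 i (Set.mem_univ i)⟩
      invFun := fun v => ⟨fun i => v i, fun i _ => (v i).2⟩
      map_add' := fun _ _ => rfl
      map_smul' := fun _ _ => rfl
      left_inv := fun _ => rfl
      right_inv := fun _ => rfl }

theorem finrank_map_eq_of_ker {M X Y : Type*} [AddCommGroup M] [Module K M] [AddCommGroup X]
    [Module K X] [AddCommGroup Y] [Module K Y] {V : Submodule K M} {f : M →ₗ[K] X} {g : M →ₗ[K] Y}
    (h : ∀ v ∈ V, f v = 0 ↔ g v = 0) :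
    Module.finrank K (V.map f) = Module.finrank K (V.map g) := by
  have hker : LinearMap.ker (f.domRestrict V) = LinearMap.ker (g.domRestrict V) := by
    ext v
    exact h v v.2
  rw [← LinearMap.range_domRestrict, ← LinearMap.range_domRestrict]
  exact (((f.domRestrict V).quotKerEquivRange.symm.trans
    (Submodule.quotEquivOfEq _ _ hker)).trans (g.domRestrict V).quotKerEquivRange).finrank_eq

end Remainder

/-! ### The monic generator, elimination ideals and multiplicities -/

section Multiplicity

variable {K : Type*} [Field K] {n : ℕ} {𝔭 : Ideal (PolyRing K n)} {a : Fin (n + 1) → K}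
  {y : PolyRing K n}

theorem mem_irrelevant_pow {d : ℕ} {f : PolyRing K n} (hf : f.IsHomogeneous d) :
    f ∈ (HomogeneousIdeal.irrelevant (stdGrading K n)).toIdeal ^ d := by
  have h1 : f ∈ MvPolynomial.homogeneousSubmodule (Fin (n + 1)) K 1 ^ d := by
    rw [MvPolynomial.homogeneousSubmodule_one_pow]
    exact hf
  clear hf
  induction d generalizing f with
  | zero => rw [pow_zero, Ideal.one_eq_top]; trivial
  | succ d ih =>
    rw [pow_succ] at h1 ⊢
    induction h1 using Submodule.mul_induction_on' with
    | mem_mul_mem u hu v hv =>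
      exact Ideal.mul_mem_mul (ih hu)
        (HomogeneousIdeal.mem_irrelevant_of_mem (stdGrading K n) one_pos hv)
    | add u _ v _ hu hv => exact add_mem hu hv

theorem aeval_mem_map_iff_mem_map_C (ha : IsConePoint 𝔭 a) (hy : y.IsHomogeneous 1)
    (hya : MvPolynomial.eval a y = 1) (I : Ideal (coordSubalgebra 𝔭))
    (P : Polynomial (coordSubalgebra 𝔭)) :
    Polynomial.aeval y P ∈ I.map (algebraMap (coordSubalgebra 𝔭) (PolyRing K n)) ↔
      P ∈ I.map Polynomial.C :=
  (aeval_mem_map_iff ha hy hya I P).trans Ideal.mem_map_C_iff.symm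

theorem aeval_mem_sup_map_iff (ha : IsConePoint 𝔭 a) (hy : y.IsHomogeneous 1)
    (hya : MvPolynomial.eval a y = 1) (I : Ideal (PolyRing K n)) (Q : Ideal (coordSubalgebra 𝔭))
    (P : Polynomial (coordSubalgebra 𝔭)) :
    Polynomial.aeval y P ∈ I ⊔ Q.map (algebraMap (coordSubalgebra 𝔭) (PolyRing K n)) ↔
      P ∈ I.comap (Polynomial.aeval y : Polynomial (coordSubalgebra 𝔭) →ₐ[coordSubalgebra 𝔭]
        PolyRing K n) ⊔ Q.map Polynomial.C := by
  constructor
  · intro h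
    obtain ⟨u, hu, v, hv, huv⟩ := Submodule.mem_sup.mp h
    obtain ⟨U, rfl⟩ := (aeval_bijective ha hy hya).2 u
    obtain ⟨V, rfl⟩ := (aeval_bijective ha hy hya).2 v
    rw [← map_add] at huv
    rw [← (aeval_bijective ha hy hya).1 huv]
    exact add_mem (Ideal.mem_sup_left hu)
      (Ideal.mem_sup_right ((aeval_mem_map_iff_mem_map_C ha hy hya Q V).mp hv))
  · intro h
    obtain ⟨U, hU, V, hV, rfl⟩ := Submodule.mem_sup.mp h
    rw [map_add]
    exact add_mem (Ideal.mem_sup_left hU)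
      (Ideal.mem_sup_right ((aeval_mem_map_iff_mem_map_C ha hy hya Q V).mpr hV))

theorem aeval_mem_span_sup_map_iff (ha : IsConePoint 𝔭 a) (hy : y.IsHomogeneous 1)
    (hya : MvPolynomial.eval a y = 1) (F : Polynomial (coordSubalgebra 𝔭))
    (Q : Ideal (coordSubalgebra 𝔭)) (P : Polynomial (coordSubalgebra 𝔭)) :
    Polynomial.aeval y P ∈ Ideal.span {Polynomial.aeval y F} ⊔
        Q.map (algebraMap (coordSubalgebra 𝔭) (PolyRing K n)) ↔
      P ∈ Ideal.span {F} ⊔ Q.map Polynomial.C := by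
  rw [aeval_mem_sup_map_iff ha hy hya]
  have h : (Ideal.span {Polynomial.aeval y F}).comap (Polynomial.aeval y :
      Polynomial (coordSubalgebra 𝔭) →ₐ[coordSubalgebra 𝔭] PolyRing K n) = Ideal.span {F} := by
    ext G
    rw [Ideal.mem_comap, Ideal.mem_span_singleton', Ideal.mem_span_singleton']
    constructor
    · rintro ⟨u, hu⟩
      obtain ⟨U, rfl⟩ := (aeval_bijective ha hy hya).2 u
      rw [← map_mul] at hu
      exact ⟨U, (aeval_bijective ha hy hya).1 hu⟩
    · rintro ⟨U, rfl⟩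
      exact ⟨_, (map_mul _ _ _).symm⟩
  rw [h]

theorem aeval_isHomogeneous_iff (ha : IsConePoint 𝔭 a) (hy : y.IsHomogeneous 1)
    (hya : MvPolynomial.eval a y = 1) (d : ℕ) (P : Polynomial (coordSubalgebra 𝔭)) :
    (Polynomial.aeval y P).IsHomogeneous d ↔ P ∈ polyGrading (subGrading 𝔭) d := by
  constructor
  · intro h
    exact ⟨natDegree_le_of_isHomogeneous ha hy hya h, fun i hi =>
      coeff_mem_subGrading ha hy hya h hi⟩
  · rintro ⟨hdeg, hcoeff⟩
    rw [Polynomial.aeval_eq_sum_range' (Nat.lt_succ_of_le hdeg)]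
    refine MvPolynomial.IsHomogeneous.sum _ _ _ fun i hi => ?_
    have hi' : i ≤ d := Nat.lt_succ_iff.mp (Finset.mem_range.mp hi)
    have h1 := (mem_subGrading.mp (hcoeff i hi')).mul (hy.pow i)
    rwa [one_mul, Nat.sub_add_cancel hi'] at h1

/-- Multiplication by `y ^ (l - k)` preserves the leading coefficient. -/
theorem natPEI_mono (ha : IsConePoint 𝔭 a) (hy : y.IsHomogeneous 1)
    (hya : MvPolynomial.eval a y = 1) (𝔞 : Ideal (PolyRing K n)) : Monotone (natPEI 𝔭 𝔞) := by
  intro k l hkl f hf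
  obtain ⟨P, hP, hPf, hP𝔞⟩ := (mem_natPEI_iff ha hy hya 𝔞 k f).mp hf
  refine (mem_natPEI_iff ha hy hya 𝔞 l f).mpr ⟨Polynomial.X ^ (l - k) * P, ?_, ?_, ?_⟩
  · refine Polynomial.natDegree_mul_le.trans ?_
    have := Polynomial.natDegree_X_pow_le (R := coordSubalgebra 𝔭) (l - k)
    omega
  · rw [← hPf, Polynomial.coeff_X_pow_mul', if_pos (Nat.sub_le _ _), Nat.sub_sub_self hkl]
  · rw [map_mul]
    exact 𝔞.mul_mem_left _ hP𝔞

theorem natPEI_zero_le (ha : IsConePoint 𝔭 a) (hy : y.IsHomogeneous 1)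
    (hya : MvPolynomial.eval a y = 1) (𝔞 : Ideal (PolyRing K n))
    (𝔮 : Ideal (coordSubalgebra 𝔭)) : natPEI 𝔭 𝔞 0 ≤ sumIdeal 𝔭 𝔞 𝔮 := by
  intro f hf
  obtain ⟨P, hP, hPf, hP𝔞⟩ := (mem_natPEI_iff ha hy hya 𝔞 0 f).mp hf
  rw [Polynomial.eq_C_of_natDegree_le_zero hP, Polynomial.aeval_C, hPf] at hP𝔞
  exact Ideal.mem_sup_left hP𝔞

theorem exists_monic_mem (ha : IsConePoint 𝔭 a) (hy : y.IsHomogeneous 1)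
    (hya : MvPolynomial.eval a y = 1) {𝔞 : Ideal (PolyRing K n)}
    (h𝔞 : 𝔞.IsHomogeneous (stdGrading K n)) (hnot : ¬ 𝔞 ≤ 𝔭) :
    ∃ P : Polynomial (coordSubalgebra 𝔭), P.Monic ∧ Polynomial.aeval y P ∈ 𝔞 ∧
      MvPolynomial.eval a (Polynomial.aeval y P) = 1 := by
  obtain ⟨f, hf, hf𝔭⟩ := SetLike.not_le_iff_exists.mp hnot
  obtain ⟨d, hd⟩ : ∃ d, MvPolynomial.homogeneousComponent d f ∉ 𝔭 := by
    by_contra! hcon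
    rw [← MvPolynomial.sum_homogeneousComponent f] at hf𝔭
    exact hf𝔭 (sum_mem fun i _ => hcon i)
  set g := MvPolynomial.homogeneousComponent d f
  have hg : g.IsHomogeneous d := MvPolynomial.homogeneousComponent_isHomogeneous d f
  have hg𝔞 : g ∈ 𝔞 := MvPolynomial.homogeneousComponent_mem_of_mem h𝔞 hf d
  have hga : MvPolynomial.eval a g ≠ 0 := fun h => hd ((ha.2 d g hg).mpr h)
  obtain ⟨P, hP⟩ := (aeval_bijective ha hy hya).2
    (MvPolynomial.C (MvPolynomial.eval a g)⁻¹ * g)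
  have h1 : MvPolynomial.eval a (Polynomial.aeval y P) = 1 := by
    rw [hP, map_mul, MvPolynomial.eval_C, inv_mul_cancel₀ hga]
  refine ⟨P, (monic_of_eval_eq_one ha hy hya (d := d) ?_ h1).1, ?_, h1⟩
  · rw [hP]
    exact hg.C_mul _
  · rw [hP]
    exact 𝔞.mul_mem_left _ hg𝔞

/-- The saturation of `𝔞 + 𝔮R` is generated modulo `JR` by a form that is monic in `y`. -/
theorem exists_monic_generator (ha : IsConePoint 𝔭 a) (hy : y.IsHomogeneous 1)
    (hya : MvPolynomial.eval a y = 1) {𝔞 : Ideal (PolyRing K n)}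
    (h𝔞 : 𝔞.IsHomogeneous (stdGrading K n)) (hnot : ¬ 𝔞 ≤ 𝔭)
    {𝔮 : Ideal (coordSubalgebra 𝔭)} (h𝔮 : 𝔮.IsHomogeneous (subGrading 𝔭))
    (htop : sumIdeal 𝔭 𝔞 𝔮 ≠ ⊤)
    (hsat : (saturation (barIdeal 𝔭 𝔞 𝔮) (barIrrelevant 𝔭 𝔞 𝔮)).IsPrincipal) :
    ∃ F : Polynomial (coordSubalgebra 𝔭), F.Monic ∧
      F ∈ polyGrading (subGrading 𝔭) F.natDegree ∧
      saturation (fibreIdeal 𝔭 𝔞 𝔮) (HomogeneousIdeal.irrelevant (stdGrading K n)).toIdeal =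
        Ideal.span {Polynomial.aeval y F} ⊔
          (sumIdeal 𝔭 𝔞 𝔮).map (algebraMap (coordSubalgebra 𝔭) (PolyRing K n)) := by
  have hJ := sumIdeal_isHomogeneous h𝔞 h𝔮
  have hfibre := fibreIdeal_isHomogeneous ha hy hya h𝔞 h𝔮
  have hE := map_isHomogeneous ha hy hya hJ
  obtain ⟨f, hf⟩ := exists_generator_of_isPrincipal (extIdeal_le_fibreIdeal 𝔞 𝔮) hsat
  rw [extIdeal_eq_map] at hf
  set E := (sumIdeal 𝔭 𝔞 𝔮).map (algebraMap (coordSubalgebra 𝔭) (PolyRing K n)) with hEdef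
  set I := saturation (fibreIdeal 𝔭 𝔞 𝔮)
    (HomogeneousIdeal.irrelevant (stdGrading K n)).toIdeal with hIdef
  have hI : I.IsHomogeneous (stdGrading K n) := fun d r hr => by
    rw [coe_decompose]
    exact homogeneousComponent_mem_saturation hfibre hr d
  obtain ⟨P, -, hP𝔞, hP1⟩ := exists_monic_mem ha hy hya h𝔞 hnot
  have hPI : Polynomial.aeval y P ∈ I := le_saturation _ _ (Ideal.mem_sup_left hP𝔞)
  have hzero : ∀ r ∈ E, MvPolynomial.eval a r = 0 := fun r hr =>
    eval_eq_zero_of_mem_map ha hy hya hJ htop hr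
  have hne : I ≠ E := fun h => by
    rw [h] at hPI
    exact one_ne_zero (hP1.symm.trans (hzero _ hPI))
  obtain ⟨d, g, hg, hIg⟩ := exists_homogeneous_generator hE hI hne hf
  -- `P` has value `1` at `a` and lies in `(g) + E`, while `E` vanishes at `a`.
  have hga : MvPolynomial.eval a g ≠ 0 := by
    intro h0
    rw [hIg] at hPI
    obtain ⟨u, hu, v, hv, huv⟩ := Submodule.mem_sup.mp hPI
    obtain ⟨w, rfl⟩ := Ideal.mem_span_singleton'.mp hu
    rw [← huv, map_add, map_mul, h0, hzero v hv] at hP1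
    simp at hP1
  have hu : IsUnit (MvPolynomial.C (MvPolynomial.eval a g)⁻¹ : PolyRing K n) :=
    (IsUnit.mk0 _ (inv_ne_zero hga)).map MvPolynomial.C
  obtain ⟨F, hF⟩ := (aeval_bijective ha hy hya).2
    (MvPolynomial.C (MvPolynomial.eval a g)⁻¹ * g)
  have h1 : MvPolynomial.eval a (Polynomial.aeval y F) = 1 := by
    rw [hF, map_mul, MvPolynomial.eval_C, inv_mul_cancel₀ hga]
  have hFhom : (Polynomial.aeval y F).IsHomogeneous d := by
    rw [hF]
    exact hg.C_mul _
  obtain ⟨hmonic, hdeg⟩ := monic_of_eval_eq_one ha hy hya hFhom h1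
  refine ⟨F, hmonic, ?_, ?_⟩
  · rw [hdeg]
    exact (aeval_isHomogeneous_iff ha hy hya d F).mp hFhom
  · rw [hIg, hF, Ideal.span_singleton_mul_left_unit hu]

/-- For large `d` the Hilbert function of `R/(𝔞 + 𝔮R)` is that of a free module of rank `deg F`
over `S/J`. -/
theorem hilbertFunction_fibre (ha : IsConePoint 𝔭 a) (hy : y.IsHomogeneous 1)
    (hya : MvPolynomial.eval a y = 1) {I : Ideal (PolyRing K n)}
    (hI : I.IsHomogeneous (stdGrading K n)) {J : Ideal (coordSubalgebra 𝔭)}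
    (hJI : J.map (algebraMap (coordSubalgebra 𝔭) (PolyRing K n)) ≤ I)
    {F : Polynomial (coordSubalgebra 𝔭)} (hF : F.Monic)
    (hFmem : F ∈ polyGrading (subGrading 𝔭) F.natDegree)
    (hsat : saturation I (HomogeneousIdeal.irrelevant (stdGrading K n)).toIdeal =
        Ideal.span {Polynomial.aeval y F} ⊔
          J.map (algebraMap (coordSubalgebra 𝔭) (PolyRing K n))) {c : ℕ}
    (hc : ∀ᶠ d in Filter.atTop, hilbertFunction
      (fun d => (subGrading 𝔭 d).map (Ideal.Quotient.mkₐ K J).toLinearMap) d = c) :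
    ∀ᶠ d in Filter.atTop, hilbertFunction
      (fun d => (stdGrading K n d).map (Ideal.Quotient.mkₐ K I).toLinearMap) d =
        F.natDegree * c := by
  obtain ⟨N, hN⟩ := Filter.eventually_atTop.mp hc
  have hFsat : Polynomial.aeval y F ∈
      saturation I (HomogeneousIdeal.irrelevant (stdGrading K n)).toIdeal :=
    hsat ▸ Ideal.mem_sup_left (Ideal.mem_span_singleton_self _)
  obtain ⟨m, hm⟩ := hFsat
  have hFhom := (aeval_isHomogeneous_iff ha hy hya F.natDegree F).mpr hFmem
  -- For such `d`, every `d - j` with `j < deg F` is at least `N`, and a form of degree `d - deg F`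
  -- lies in `R₊ ^ m`, which multiplies `F` into `I`.
  refine Filter.eventually_atTop.mpr ⟨F.natDegree + m + N, fun d hd => ?_⟩
  let α : Polynomial (coordSubalgebra 𝔭) →ₗ[K] PolyRing K n :=
    ((Polynomial.aeval y : Polynomial (coordSubalgebra 𝔭) →ₐ[coordSubalgebra 𝔭]
      PolyRing K n).restrictScalars K).toLinearMap
  have hα : (polyGrading (subGrading 𝔭) d).map α = stdGrading K n d := by
    ext r
    constructor
    · rintro ⟨P, hP, rfl⟩
      exact (aeval_isHomogeneous_iff ha hy hya d P).mpr hP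
    · intro hr
      obtain ⟨P, rfl⟩ := (aeval_bijective ha hy hya).2 r
      exact ⟨P, (aeval_isHomogeneous_iff ha hy hya d P).mp hr, rfl⟩
  -- In degree `d` the ideal `I` already coincides with its saturation, so both maps have the same
  -- kernel.
  have hker : ∀ P ∈ polyGrading (subGrading 𝔭) d,
      ((Ideal.Quotient.mkₐ K I).toLinearMap.comp α) P = 0 ↔ remainderCoeffs K J F P = 0 := by
    intro P hP
    rw [remainderCoeffs_eq_zero_iff hF, ← aeval_mem_span_sup_map_iff ha hy hya, ← hsat]
    refine Ideal.Quotient.eq_zero_iff_mem.trans ⟨fun h => le_saturation _ _ h, fun h => ?_⟩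
    change Polynomial.aeval y P ∈ I
    have hPhom := (aeval_isHomogeneous_iff ha hy hya d P).mpr hP
    rw [hsat] at h
    obtain ⟨u, hu, v, hv, huv⟩ := Submodule.mem_sup.mp h
    obtain ⟨w, rfl⟩ := Ideal.mem_span_singleton'.mp hu
    rw [← MvPolynomial.homogeneousComponent_eq_self hPhom, ← huv, map_add]
    refine add_mem ?_ (MvPolynomial.homogeneousComponent_mem_of_mem hI (hJI hv) d)
    rw [← Nat.sub_add_cancel (show F.natDegree ≤ d by omega),
      homogeneousComponent_mul_of_isHomogeneous hFhom, mul_comm]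
    exact hm _ (Ideal.pow_le_pow_right (show m ≤ d - F.natDegree by omega)
      (mem_irrelevant_pow (MvPolynomial.homogeneousComponent_isHomogeneous _ _)))
  rw [hilbertFunction, ← hα, ← Submodule.map_comp, finrank_map_eq_of_ker hker,
    map_remainderCoeffs J hF hFmem (by omega), finrank_submodule_pi]
  refine (Finset.sum_congr rfl fun (j : Fin F.natDegree) _ =>
    hN (d - (j : ℕ)) (by have := j.2; omega)).trans ?_
  simp

/-- The monic `f` makes `R/(𝔞 + 𝔮R)` finite over `S`. The kernel of `S → R/(𝔞 + 𝔮R)` contains `J`;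
the determinant trick shows that it lies in the radical of `J`. -/
theorem ringKrullDim_fibre (ha : IsConePoint 𝔭 a) (hy : y.IsHomogeneous 1)
    (hya : MvPolynomial.eval a y = 1) {𝔞 : Ideal (PolyRing K n)}
    {f : Polynomial (coordSubalgebra 𝔭)} (hf : f.Monic) (hf𝔞 : Polynomial.aeval y f ∈ 𝔞)
    {𝔮 : Ideal (coordSubalgebra 𝔭)}
    (hdim : ringKrullDim (coordSubalgebra 𝔭 ⧸ sumIdeal 𝔭 𝔞 𝔮) = 1) :
    ringKrullDim (PolyRing K n ⧸ fibreIdeal 𝔭 𝔞 𝔮) = 1 := by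
  have hfin : Module.Finite (coordSubalgebra 𝔭) (PolyRing K n ⧸ fibreIdeal 𝔭 𝔞 𝔮) :=
    finite_quotient_of_aeval_mem (aeval_bijective ha hy hya).2 hf (Ideal.mem_sup_left hf𝔞)
  have hker : ∀ s : coordSubalgebra 𝔭, s ∈ RingHom.ker (algebraMap (coordSubalgebra 𝔭)
      (PolyRing K n ⧸ fibreIdeal 𝔭 𝔞 𝔮)) ↔
      algebraMap (coordSubalgebra 𝔭) (PolyRing K n) s ∈ fibreIdeal 𝔭 𝔞 𝔮 :=
    fun s => Ideal.Quotient.eq_zero_iff_mem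
  refine ringKrullDim_eq_one_of_isIntegral (A := coordSubalgebra 𝔭) (J := sumIdeal 𝔭 𝔞 𝔮)
    (fun s hs => ?_) (fun s hs => ?_) hdim
  · rw [hker]
    refine extIdeal_le_fibreIdeal 𝔞 𝔮 ?_
    rw [extIdeal_eq_map]
    exact Ideal.mem_map_of_mem _ hs
  · rw [hker, ← Polynomial.aeval_C y s, fibreIdeal, aeval_mem_sup_map_iff ha hy hya] at hs
    -- With `F = 1` the polynomial found has degree `0`, so `s ^ r + q ∈ 𝔞 ∩ S`.
    obtain ⟨r, q, hq, P, hPI, hPdeg, hPc⟩ := exists_mem_of_C_mul_mem_sup hf hf𝔞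
      (F := 1) Polynomial.monic_one (t := s) (by rwa [mul_one])
    rw [Polynomial.natDegree_one] at hPdeg hPc
    refine ⟨r, ?_⟩
    have h1 : s ^ r + q ∈ sumIdeal 𝔭 𝔞 𝔮 := natPEI_zero_le ha hy hya 𝔞 𝔮
      ((mem_natPEI_iff ha hy hya 𝔞 0 _).mpr ⟨P, hPdeg, hPc, hPI⟩)
    exact (Ideal.add_mem_iff_left _ (Ideal.mem_sup_right hq)).mp h1

theorem natPEI_le_sumIdeal_iff (ha : IsConePoint 𝔭 a) (hy : y.IsHomogeneous 1)
    (hya : MvPolynomial.eval a y = 1) {𝔞 : Ideal (PolyRing K n)}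
    {f : Polynomial (coordSubalgebra 𝔭)} (hf : f.Monic) (hf𝔞 : Polynomial.aeval y f ∈ 𝔞)
    {𝔮 : Ideal (coordSubalgebra 𝔭)}
    (hdim : ringKrullDim (coordSubalgebra 𝔭 ⧸ sumIdeal 𝔭 𝔞 𝔮) = 1)
    {F : Polynomial (coordSubalgebra 𝔭)} (hF : F.Monic)
    (hsat : saturation (fibreIdeal 𝔭 𝔞 𝔮) (HomogeneousIdeal.irrelevant (stdGrading K n)).toIdeal =
        Ideal.span {Polynomial.aeval y F} ⊔
          (sumIdeal 𝔭 𝔞 𝔮).map (algebraMap (coordSubalgebra 𝔭) (PolyRing K n))) (k : ℕ) :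
    natPEI 𝔭 𝔞 k ≤ sumIdeal 𝔭 𝔞 𝔮 ↔ k < F.natDegree := by
  constructor
  · intro hk
    by_contra hlt
    have he : natPEI 𝔭 𝔞 F.natDegree ≤ sumIdeal 𝔭 𝔞 𝔮 :=
      (natPEI_mono ha hy hya 𝔞 (not_lt.mp hlt)).trans hk
    have hFsat : Polynomial.aeval y F ∈ saturation (fibreIdeal 𝔭 𝔞 𝔮)
        (HomogeneousIdeal.irrelevant (stdGrading K n)).toIdeal :=
      hsat ▸ Ideal.mem_sup_left (Ideal.mem_span_singleton_self _)
    obtain ⟨m, hm⟩ := hFsat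
    -- A power of `l` multiplies `F` into `𝔞 + 𝔮R`. If `𝒦_e(𝔞)` were inside `J`, the determinant
    -- trick would make `l` nilpotent modulo `J`.
    obtain ⟨l, hl, hlJ⟩ := exists_mem_subGrading_one_notMem ha hy hya hdim
    have hlm : ((l ^ m : coordSubalgebra 𝔭) : PolyRing K n).IsHomogeneous m := by
      have := (mem_subGrading.mp hl).pow m
      rwa [one_mul] at this
    have h1 : Polynomial.aeval y (Polynomial.C (l ^ m) * F) ∈ fibreIdeal 𝔭 𝔞 𝔮 := by
      rw [map_mul, Polynomial.aeval_C, mul_comm]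
      exact hm _ (mem_irrelevant_pow hlm)
    rw [fibreIdeal, aeval_mem_sup_map_iff ha hy hya] at h1
    obtain ⟨r, q, hq, P, hPI, hPdeg, hPc⟩ := exists_mem_of_C_mul_mem_sup hf hf𝔞 hF h1
    have h2 : (l ^ m) ^ r + q ∈ sumIdeal 𝔭 𝔞 𝔮 :=
      he ((mem_natPEI_iff ha hy hya 𝔞 _ _).mpr ⟨P, hPdeg, hPc, hPI⟩)
    refine hlJ ⟨m * r, ?_⟩
    rw [pow_mul]
    exact (Ideal.add_mem_iff_left _ (Ideal.mem_sup_right hq)).mp h2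
  · intro hk g hg
    obtain ⟨P, hP, rfl, hP𝔞⟩ := (mem_natPEI_iff ha hy hya 𝔞 k g).mp hg
    have h1 : Polynomial.aeval y P ∈ saturation (fibreIdeal 𝔭 𝔞 𝔮)
        (HomogeneousIdeal.irrelevant (stdGrading K n)).toIdeal :=
      le_saturation _ _ (Ideal.mem_sup_left hP𝔞)
    rw [hsat, aeval_mem_span_sup_map_iff ha hy hya] at h1
    exact coeff_mem_of_mem_span_sup hF (hP.trans_lt hk) h1 k

end Multiplicity

end PartialElimination

/-! ### The theorem -/

theorem mainTheorem2 {K : Type*} [Field K] [IsAlgClosed K] (n : ℕ)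
    (𝔭 : ProjectiveSpectrum (PartialElimination.stdGrading K n)) (h𝔭 : IsMax 𝔭)
    (𝔞 : HomogeneousIdeal (PartialElimination.stdGrading K n))
    (h𝔞𝔭 : ¬ 𝔞 ≤ 𝔭.asHomogeneousIdeal)
    (𝔮 : HomogeneousIdeal (PartialElimination.subGrading 𝔭.asHomogeneousIdeal.toIdeal))
    (hdim : ringKrullDim (PartialElimination.coordSubalgebra 𝔭.asHomogeneousIdeal.toIdeal ⧸
      PartialElimination.sumIdeal 𝔭.asHomogeneousIdeal.toIdeal 𝔞.toIdeal 𝔮.toIdeal) = 1)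
    (hsat : (PartialElimination.saturation
      (PartialElimination.barIdeal 𝔭.asHomogeneousIdeal.toIdeal 𝔞.toIdeal 𝔮.toIdeal)
      (PartialElimination.barIrrelevant
        𝔭.asHomogeneousIdeal.toIdeal 𝔞.toIdeal 𝔮.toIdeal)).IsPrincipal) :
    ∃ k₀ : ℤ,
      IsGreatest {k : ℤ | -1 ≤ k ∧
        PartialElimination.partialElim 𝔭.asHomogeneousIdeal.toIdeal 𝔞.toIdeal k ≤
          PartialElimination.sumIdeal 𝔭.asHomogeneousIdeal.toIdeal 𝔞.toIdeal 𝔮.toIdeal} k₀ ∧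
      PartialElimination.quotientMultiplicity (PartialElimination.stdGrading K n)
          (PartialElimination.fibreIdeal 𝔭.asHomogeneousIdeal.toIdeal 𝔞.toIdeal 𝔮.toIdeal) =
        ((k₀ : ℚ) + 1) *
          PartialElimination.quotientMultiplicity
            (PartialElimination.subGrading 𝔭.asHomogeneousIdeal.toIdeal)
            (PartialElimination.sumIdeal 𝔭.asHomogeneousIdeal.toIdeal 𝔞.toIdeal 𝔮.toIdeal) := by
  open PartialElimination in
  obtain ⟨a, ha⟩ := exists_isConePoint 𝔭 h𝔭
  obtain ⟨y, hy, hya⟩ := exists_linear_eval_eq_one ha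
  have : Infinite K := IsAlgClosed.instInfinite
  have h𝔞 := 𝔞.isHomogeneous
  have h𝔮 := 𝔮.isHomogeneous
  have hJ := sumIdeal_isHomogeneous h𝔞 h𝔮
  have htop : sumIdeal 𝔭.asHomogeneousIdeal.toIdeal 𝔞.toIdeal 𝔮.toIdeal ≠ ⊤ := by
    intro h
    have := Ideal.Quotient.subsingleton_iff.mpr h
    rw [ringKrullDim_eq_bot_of_subsingleton] at hdim
    exact absurd hdim (by simp)
  obtain ⟨f, hf, hf𝔞, -⟩ := exists_monic_mem ha hy hya h𝔞 h𝔞𝔭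
  obtain ⟨F, hF, hFmem, hFsat⟩ := exists_monic_generator ha hy hya h𝔞 h𝔞𝔭 h𝔮 htop hsat
  have hiff := natPEI_le_sumIdeal_iff ha hy hya hf hf𝔞 hdim hF hFsat
  -- `𝒦_0(𝔞) = 𝔞 ∩ S` lies in `J`, so `deg F ≥ 1` and `k₀ = deg F - 1` is a natural number.
  have hpos : 0 < F.natDegree := (hiff 0).mp (natPEI_zero_le ha hy hya _ _)
  obtain ⟨c, hc⟩ := exists_hilbertFunction_eq ha hy hya hJ hdim
  have hJI := (extIdeal_eq_map 𝔞.toIdeal 𝔮.toIdeal).ge.trans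
    (extIdeal_le_fibreIdeal 𝔞.toIdeal 𝔮.toIdeal)
  have hc' := hilbertFunction_fibre ha hy hya (fibreIdeal_isHomogeneous ha hy hya h𝔞 h𝔮) hJI
    hF hFmem hFsat hc
  obtain ⟨k, hk⟩ := Nat.exists_eq_add_of_le' hpos
  refine ⟨k, ⟨⟨by omega, (hiff k).mpr (by omega)⟩, ?_⟩, ?_⟩
  · rintro (l | l) ⟨-, hl⟩
    · have := (hiff l).mp hl
      exact Int.ofNat_le.mpr (by omega)
    · exact (Int.negSucc_lt_zero l).le.trans (Int.natCast_nonneg k)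
  · rw [quotientMultiplicity_eq hdim hc,
      quotientMultiplicity_eq (ringKrullDim_fibre ha hy hya hf hf𝔞 hdim) hc', hk]
    push_cast
    ring
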